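/- Let $X$ be a compact Hausdorff space, $U\subset X$ a dense open subset, $\partial U=X\setminus U$ its boundary, and consider the essential extension of commutative $C^*$-algebras $$0\to C_0(U)\to C(X)\to C(\partial U)\to 0 \qquad (3)$$ (extension of functions by zero, followed by restriction). Let $\beta U$ be the Stone–Čech compactification of $U$; the continuous extension $\beta U\to X$ of the inclusion $U\subset X$ maps $\beta U\setminus U$ to $\partial U$, and induces $\delta:C(\partial U)\to C(\beta U\setminus U)$. For a Hilbert $C^*$-module $V$ over $C_0(U)$ let $M(V)$ be the module of adjointable maps $C_0(U)\to V$, a Hilbert $C^*$-module over the multiplier algebra $C(\beta U)$ of $C_0(U)$, and let $Q(V)=M(V)/V$ be the quotient Hilbert $C^*$-module over $C(\beta U\setminus U)$, where $V\subset M(V)$ via $v\mapsto (a\mapsto va)$. A Hilbert $C^*$-module extension of $Z$ by $V$ with underlying $C^*$-algebra extension (3) is a short exact sequence $0\to V\to W\to Z\to 0$, where $W$ is a Hilbert $C^*$-module over $C(X)$, $Z$ is a Hilbert $C^*$-module over $C(\partial U)$, and the two maps are compatible, via the maps in (3), with the inner products. Its Busby invariant is the map $\Delta_W:Z\to Q(V)$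 that sends the image of $w\in W$ to the class of the multiplier $a\mapsto wa\in V$, $a\in C_0(U)$; it is a $\delta$-morphism, that is, $\langle\Delta_W(z),\Delta_W(z')\rangle=\delta(\langle z,z'\rangle)$ for all $z,z'\in Z$. Two extensions $W_0$, $W_1$ are homotopic if there are $\delta$-morphisms $\Delta_t:Z\to Q(V)$, $t\in[0,1]$, with $\Delta_0=\Delta_{W_0}$, $\Delta_1=\Delta_{W_1}$, such that $t\mapsto\Delta_t(z)$ is norm-continuous for every $z\in Z$. **Theorem.** Let $k,m\ge 0$, let $Z$ be a Hilbert $C^*$-module over $C(\partial U)$ that is a free module of rank $k$, and let $V$ be a Hilbert $C^*$-module over $C_0(U)$ such that $Q(V)$ is a free module of rank $m$ over $C(\beta U\setminus U)$. Then the set of homotopy classes of Hilbert $C^*$-module extensions of $Z$ by $V$ with underlying $C^*$-algebra extension (3) is in one-to-one correspondence with the set $[\beta U\setminus U,V_{k,m}]$ of homotopy classes of continuous maps from the Stone–Čech corona $\beta U\setminus U$ to the Stiefel manifold $V_{k,m}$ of orthonormal $k$-frames in $\mathbb C^m$. More precisely, there are orthonormal bases $(e_j)_{j\le k}$ of $Z$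 and $(b_i)_{i\le m}$ of $Q(V)$ such that the correspondence sends the class of an extension $W$ to the class of the map $p\mapsto\big((\langle b_i,\Delta_W(e_j)\rangle(p))_{i\le m}\big)_{j\le k}$. Moreover, $Q(V)$ is free of rank $m$ for $V=C_0(U)^m$. -/

import Mathlib

open scoped ComplexOrder ZeroAtInfty
open Topology

set_option linter.unusedSectionVars false

noncomputable section

namespace HilbertModuleExtensions

universe u v w

/-! ### The pointwise order on `C₀(Y, ℂ)` -/

section Order

variable {Y : Type*} [TopologicalSpace Y]

/-- The pointwise partial order on `C₀(Y, ℂ)`. -/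
instance instPartialOrderC0 : PartialOrder C₀(Y, ℂ) :=
  PartialOrder.lift (fun f : C₀(Y, ℂ) => (f : Y → ℂ)) DFunLike.coe_injective

theorem c0_le_iff {f g : C₀(Y, ℂ)} : f ≤ g ↔ ∀ y, f y ≤ g y := Iff.rfl

instance instStarOrderedRingC0 : StarOrderedRing C₀(Y, ℂ) := by
  refine StarOrderedRing.of_le_iff fun f g => ⟨fun h => ?_, ?_⟩
  · have h0 : ∀ y, 0 ≤ g y - f y := fun y => sub_nonneg.2 (h y)
    refine ⟨⟨⟨fun y => ((Real.sqrt (g y - f y).re : ℝ) : ℂ), by fun_prop⟩, ?_⟩, ?_⟩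
    · have h1 : Filter.Tendsto (fun y => (g - f) y) (Filter.cocompact Y) (𝓝 0) :=
        zero_at_infty (g - f)
      have h2 : Continuous fun z : ℂ => ((Real.sqrt z.re : ℝ) : ℂ) := by fun_prop
      have h3 := (h2.tendsto 0).comp h1
      simpa [Function.comp_def] using h3
    · ext y
      have h2 := Complex.nonneg_iff.1 (h0 y)
      have h3 : ((Real.sqrt (g y - f y).re : ℝ) : ℂ) * ((Real.sqrt (g y - f y).re : ℝ) : ℂ)
          = g y - f y := by
        rw [← Complex.ofReal_mul, Real.mul_self_sqrt h2.1]
        exact Complex.ext (by simp) (by simpa using h2.2)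
      have h4 : g y = f y + star ((Real.sqrt (g y - f y).re : ℝ) : ℂ)
          * ((Real.sqrt (g y - f y).re : ℝ) : ℂ) := by
        rw [Complex.star_def, Complex.conj_ofReal, h3]; ring
      exact h4
  · rintro ⟨s, rfl⟩ y
    have h4 : 0 ≤ star (s y) * s y := star_mul_self_nonneg (s y)
    have h5 : (f + star s * s) y = f y + star (s y) * s y := rfl
    change f y ≤ (f + star s * s) y
    rw [h5]
    exact le_add_of_nonneg_right h4

end Order

/-! ### The Stone–Čech corona -/

section Corona

variable (Y : Type*) [TopologicalSpace Y]

/-- The Stone–Čech corona `βY ∖ Y`. -/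
abbrev Corona : Type _ := ↥((Set.range (stoneCechUnit : Y → StoneCech Y))ᶜ)

variable {Y}

/-- Restriction of functions from `βY` to `βY ∖ Y`. -/
def coronaRestrict : C(StoneCech Y, ℂ) →+* C(Corona Y, ℂ) where
  toFun G := G.comp ⟨Subtype.val, continuous_subtype_val⟩
  map_one' := rfl
  map_mul' _ _ := rfl
  map_zero' := rfl
  map_add' _ _ := rfl

theorem coronaRestrict_apply (G : C(StoneCech Y, ℂ)) (p : Corona Y) :
    coronaRestrict G p = G p.1 := rfl

/-- Two continuous functions on `βY` that agree on `Y` are equal. -/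
theorem stoneCech_ext {G H : C(StoneCech Y, ℂ)}
    (h : ∀ y, G (stoneCechUnit y) = H (stoneCechUnit y)) : G = H :=
  DFunLike.coe_injective
    (stoneCech_hom_ext G.continuous H.continuous (funext h))

/-- A function on `βY` whose restriction to `Y` vanishes at infinity is zero on the corona. -/
theorem coronaRestrict_eq_zero {G : C(StoneCech Y, ℂ)} (f : C₀(Y, ℂ))
    (h : ∀ y, G (stoneCechUnit y) = f y) : coronaRestrict G = 0 := by
  ext p
  rw [coronaRestrict_apply, ContinuousMap.zero_apply, ← norm_le_zero_iff]
  refine le_of_forall_pos_le_add fun ε hε => ?_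
  rw [zero_add]
  have hf : ∀ᶠ y in Filter.cocompact Y, ‖f y‖ < ε := by
    have := (zero_at_infty f).norm
    rw [norm_zero] at this
    exact this.eventually (gt_mem_nhds hε)
  obtain ⟨K, hK, hKf⟩ := Filter.mem_cocompact.1 hf
  have hKc : IsClosed (stoneCechUnit '' K) := (hK.image continuous_stoneCechUnit).isClosed
  have hp : (p : StoneCech Y) ∈ (stoneCechUnit '' K)ᶜ := fun ⟨y, _, hy⟩ => p.2 ⟨y, hy⟩
  have hcl : (p : StoneCech Y) ∈ closure (Set.range stoneCechUnit ∩ (stoneCechUnit '' K)ᶜ) := by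
    rw [Set.inter_comm]
    exact denseRange_stoneCechUnit.open_subset_closure_inter hKc.isOpen_compl hp
  refine closure_minimal (t := {q | ‖G q‖ ≤ ε}) ?_
    (isClosed_le (by fun_prop) continuous_const) hcl
  rintro _ ⟨⟨y, rfl⟩, hy⟩
  have : y ∈ Kᶜ := fun hyK => hy ⟨y, hyK, rfl⟩
  have h2 : ‖f y‖ < ε := hKf this
  simpa [h y] using h2.le

/-- Every bounded continuous function on `Y` extends to `βY`. -/
theorem exists_stoneCech_extension (h : Y → ℂ) (hc : Continuous h) (C : ℝ)
    (hC : ∀ y, ‖h y‖ ≤ C) : ∃ G : C(StoneCech Y, ℂ), ∀ y, G (stoneCechUnit y) = h y := by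
  let g : Y → Metric.closedBall (0 : ℂ) C := fun y => ⟨h y, by simpa using hC y⟩
  have hg : Continuous g := hc.subtype_mk _
  have : CompactSpace (Metric.closedBall (0 : ℂ) C) :=
    isCompact_iff_compactSpace.1 (isCompact_closedBall _ _)
  refine ⟨⟨fun p => (stoneCechExtend hg p : Metric.closedBall (0 : ℂ) C).1,
    continuous_subtype_val.comp (continuous_stoneCechExtend hg)⟩, fun y => ?_⟩
  exact congrArg Subtype.val (stoneCechExtend_stoneCechUnit hg y)

/-- Local units of `C₀(Y)`. -/
theorem exists_local_unit [T35Space Y] [LocallyCompactSpace Y] (y : Y) :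
    ∃ a : C₀(Y, ℂ), (∀ᶠ x in 𝓝 y, a x = 1) ∧ ‖a‖ ≤ 1 := by
  obtain ⟨K, hK, hyK⟩ := exists_compact_mem_nhds y
  obtain ⟨f, hf1, -, hfc, hf01⟩ :=
    exists_continuous_one_zero_of_isCompact hK isClosed_empty (Set.disjoint_empty K)
  refine ⟨⟨⟨fun x => (f x : ℂ), by fun_prop⟩, ?_⟩, ?_, ?_⟩
  · have h1 : HasCompactSupport (fun x => (f x : ℂ)) := hfc.comp_left (g := Complex.ofReal) rfl
    exact h1.is_zero_at_infty
  · filter_upwards [hyK] with x hx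
    have : f x = 1 := hf1 hx
    simp [this]
  · rw [← ZeroAtInftyContinuousMap.norm_toBCF_eq_norm]
    refine (BoundedContinuousFunction.norm_le zero_le_one).2 fun x => ?_
    have h1 : ‖((f x : ℝ) : ℂ)‖ ≤ 1 := by
      rw [Complex.norm_real, Real.norm_eq_abs, abs_of_nonneg (hf01 x).1]
      exact (hf01 x).2
    exact h1

theorem isClosed_corona [T35Space Y] [LocallyCompactSpace Y] :
    IsClosed ((Set.range (stoneCechUnit : Y → StoneCech Y))ᶜ) := by
  rw [isClosed_compl_iff, isOpen_iff_mem_nhds]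
  rintro _ ⟨y, rfl⟩
  obtain ⟨a, ha, -⟩ := exists_local_unit y
  obtain ⟨G, hG⟩ := exists_stoneCech_extension a a.continuous ‖a‖
    (fun x => (a.toBCF.norm_coe_le_norm x))
  have h0 := coronaRestrict_eq_zero a hG
  have hy : G (stoneCechUnit y) ≠ 0 := by rw [hG, ha.self_of_nhds]; exact one_ne_zero
  filter_upwards [G.continuous.continuousAt.eventually_ne hy] with p hp
  by_contra hpr
  exact hp (DFunLike.congr_fun h0 (⟨p, hpr⟩ : Corona Y))

instance instCompactSpaceCorona [T35Space Y] [LocallyCompactSpace Y] : CompactSpace (Corona Y) :=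
  isCompact_iff_compactSpace.1 isClosed_corona.isCompact

theorem coronaRestrict_surjective [T35Space Y] [LocallyCompactSpace Y] :
    Function.Surjective (coronaRestrict : C(StoneCech Y, ℂ) →+* C(Corona Y, ℂ)) := fun f => by
  obtain ⟨G, hG⟩ := ContinuousMap.exists_restrict_eq isClosed_corona f
  exact ⟨G, hG⟩

/-- A function on `βY` that is zero on the corona restricts to an element of `C₀(Y)`. -/
theorem exists_c0_of_coronaRestrict_eq_zero [T35Space Y] {G : C(StoneCech Y, ℂ)} (h : coronaRestrict G = 0) :
    ∃ f : C₀(Y, ℂ), ∀ y, f y = G (stoneCechUnit y) := by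
  refine ⟨⟨⟨fun y => G (stoneCechUnit y), G.continuous.comp continuous_stoneCechUnit⟩, ?_⟩,
    fun _ => rfl⟩
  change Filter.Tendsto (fun y => G (stoneCechUnit y)) _ _
  rw [Metric.tendsto_nhds]
  intro ε hε
  have hc : IsCompact {q : StoneCech Y | ε ≤ ‖G q‖} :=
    (isClosed_le continuous_const (by fun_prop)).isCompact
  have hsub : {q : StoneCech Y | ε ≤ ‖G q‖} ⊆ Set.range stoneCechUnit := by
    intro q hq
    by_contra hqr
    have : G q = 0 := DFunLike.congr_fun h (⟨q, hqr⟩ : Corona Y)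
    rw [Set.mem_ofPred_eq, this, norm_zero] at hq
    exact absurd hq (not_le.2 hε)
  refine Filter.mem_cocompact.2
    ⟨_, (isEmbedding_stoneCechUnit.isInducing.isCompact_preimage_iff hsub).2 hc, ?_⟩
  intro y hy
  have : ¬ ε ≤ ‖G (stoneCechUnit y)‖ := hy
  simpa using this

end Corona

/-! ### The multiplier module and the quotient module -/

section Multiplier

variable (A : Type u) [NonUnitalCStarAlgebra A] [PartialOrder A] [StarOrderedRing A]
variable (V : Type v) [NormedAddCommGroup V] [NormedSpace ℂ V] [SMul A V] [CStarModule A V]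

/-- The adjointable maps to `V` from `A`, the latter viewed as a Hilbert module over itself. -/
def adjointableMaps : Submodule ℂ (A →L[ℂ] V) where
  carrier := {T | ∃ S : V → A, ∀ (a : A) (x : V), inner A (T a) x = inner A a (S x)}
  add_mem' := by
    rintro T T' ⟨S, hS⟩ ⟨S', hS'⟩
    exact ⟨S + S', fun a x => by simp [hS, hS']⟩
  zero_mem' := ⟨0, fun a x => by simp⟩
  smul_mem' := by
    rintro c T ⟨S, hS⟩
    refine ⟨fun x => star c • S x, fun a x => ?_⟩
    rw [_root_.smul_apply, CStarModule.inner_smul_left_complex, hS,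
      CStarModule.inner_smul_right_complex]

/-- The multiplier module `M(V)`: the adjointable maps `A → V`, with the operator norm. -/
def MultiplierModule : Type max u v := ↥(adjointableMaps A V)

instance : NormedAddCommGroup (MultiplierModule A V) :=
  inferInstanceAs (NormedAddCommGroup ↥(adjointableMaps A V))

instance : NormedSpace ℂ (MultiplierModule A V) :=
  inferInstanceAs (NormedSpace ℂ ↥(adjointableMaps A V))

instance : CoeFun (MultiplierModule A V) (fun _ => A → V) := ⟨fun T => T.1⟩

variable {A V}

theorem hilbert_ext {x y : V} (h : ∀ z : V, inner A x z = inner A y z) : x = y := by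
  rw [← sub_eq_zero, ← CStarModule.inner_self (A := A), CStarModule.inner_sub_left, h, sub_self]

theorem multiplier_ext {T S : MultiplierModule A V} (h : ∀ a, T a = S a) : T = S :=
  Subtype.ext (ContinuousLinearMap.ext h)

theorem multiplier_add_apply (T S : MultiplierModule A V) (a : A) : (T + S) a = T a + S a := rfl

theorem multiplier_sub_apply (T S : MultiplierModule A V) (a : A) : (T - S) a = T a - S a := rfl

theorem multiplier_smul_apply (c : ℂ) (T : MultiplierModule A V) (a : A) :
    (c • T) a = c • T a := rfl

/-- Elements of `M(V)` are `A`-linear. -/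
theorem multiplier_map_mul (T : MultiplierModule A V) (a b : A) : T (a * b) = a • T b := by
  obtain ⟨S, hS⟩ := T.2
  refine hilbert_ext (A := A) fun x => ?_
  rw [CStarModule.inner_op_smul_left, hS, hS, WithCStarModule.inner_def,
    WithCStarModule.inner_def, star_mul, mul_assoc]

theorem norm_hilbert_smul_le (a : A) (x : V) : ‖a • x‖ ≤ ‖x‖ * ‖a‖ := by
  have h1 := CStarModule.norm_sq_eq A (x := x)
  have h2 := CStarModule.norm_sq_eq A (x := a • x)
  rw [CStarModule.inner_op_smul_right, CStarModule.inner_op_smul_left] at h2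
  have h3 : ‖a • x‖ ^ 2 ≤ (‖x‖ * ‖a‖) ^ 2 := by
    rw [h2]
    refine (norm_mul_le _ _).trans ?_
    refine (mul_le_mul_of_nonneg_left (norm_mul_le _ _) (norm_nonneg _)).trans ?_
    rw [norm_star, ← h1]
    apply le_of_eq; ring
  exact le_of_sq_le_sq h3 (by positivity)

variable (A) in
/-- The map `a ↦ a • x` from `A` to `V`. -/
def smulMap (x : V) : MultiplierModule A V :=
  ⟨LinearMap.mkContinuous
    { toFun := fun a => a • x
      map_add' := fun a b => hilbert_ext (A := A) fun z => by
        simp [mul_add]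
      map_smul' := fun c a => hilbert_ext (A := A) fun z => by
        rw [RingHom.id_apply, CStarModule.inner_smul_left_complex, CStarModule.inner_op_smul_left,
          CStarModule.inner_op_smul_left, star_smul, mul_smul_comm] } ‖x‖
    (fun a => norm_hilbert_smul_le a x),
    fun z => inner A x z, fun a z => by
      change inner A (a • x) z = _
      rw [CStarModule.inner_op_smul_left, WithCStarModule.inner_def]⟩

theorem smulMap_apply (x : V) (a : A) : smulMap A x a = a • x := rfl

variable (A V) in
/-- The canonical map `Γ : V → M(V)`, `Γ(x)(a) = a • x`. -/
def multiplierIncl : V →ₗ[ℂ] MultiplierModule A V where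
  toFun := smulMap A
  map_add' x x' := multiplier_ext fun a => hilbert_ext (A := A) fun z => by
    rw [multiplier_add_apply, smulMap_apply, smulMap_apply, smulMap_apply]
    simp [add_mul]
  map_smul' c x := multiplier_ext fun a => hilbert_ext (A := A) fun z => by
    rw [RingHom.id_apply, multiplier_smul_apply, smulMap_apply, smulMap_apply,
      CStarModule.inner_smul_left_complex, CStarModule.inner_op_smul_left,
      CStarModule.inner_op_smul_left, CStarModule.inner_smul_left_complex, smul_mul_assoc]

theorem multiplierIncl_apply (x : V) (a : A) : multiplierIncl A V x a = a • x := rfl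

variable (A V) in
/-- The quotient module `Q(V) = M(V) / V`, with the quotient norm. -/
def QuotientModule : Type max u v :=
  MultiplierModule A V ⧸ LinearMap.range (multiplierIncl A V)

instance : SeminormedAddCommGroup (QuotientModule A V) :=
  inferInstanceAs (SeminormedAddCommGroup
    (MultiplierModule A V ⧸ LinearMap.range (multiplierIncl A V)))

instance : NormedSpace ℂ (QuotientModule A V) :=
  inferInstanceAs (NormedSpace ℂ (MultiplierModule A V ⧸ LinearMap.range (multiplierIncl A V)))

variable (A V) in
/-- The quotient map `Σ : M(V) → Q(V)`. -/
def toQuotient : MultiplierModule A V →ₗ[ℂ] QuotientModule A V :=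
  (LinearMap.range (multiplierIncl A V)).mkQ

theorem toQuotient_surjective : Function.Surjective (toQuotient A V) :=
  Submodule.mkQ_surjective _

theorem toQuotient_eq_zero_iff (T : MultiplierModule A V) :
    toQuotient A V T = 0 ↔ ∃ x : V, multiplierIncl A V x = T :=
  Submodule.Quotient.mk_eq_zero _

end Multiplier

/-! ### The case `A = C₀(Y)` -/

section Commutative

variable {Y : Type u} [TopologicalSpace Y]
variable {V : Type v} [NormedAddCommGroup V] [NormedSpace ℂ V] [SMul C₀(Y, ℂ) V]
  [CStarModule C₀(Y, ℂ) V]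

theorem norm_c0_apply_le (f : C₀(Y, ℂ)) (y : Y) : ‖f y‖ ≤ ‖f‖ :=
  f.toBCF.norm_coe_le_norm y

theorem norm_c0_le {f : C₀(Y, ℂ)} {C : ℝ} (hC : 0 ≤ C) (h : ∀ y, ‖f y‖ ≤ C) : ‖f‖ ≤ C := by
  rw [← ZeroAtInftyContinuousMap.norm_toBCF_eq_norm]
  exact (BoundedContinuousFunction.norm_le hC).2 h

theorem norm_le_of_inner_apply {x : V} {C : ℝ} (hC : 0 ≤ C)
    (h : ∀ y, ‖inner C₀(Y, ℂ) x x y‖ ≤ C ^ 2) : ‖x‖ ≤ C := by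
  have h1 := CStarModule.norm_sq_eq C₀(Y, ℂ) (x := x)
  exact le_of_sq_le_sq (h1 ▸ norm_c0_le (by positivity) h) hC

/-- If `⟨T, T⟩` vanishes at infinity then `T` lies in the image of `V`. -/
theorem exists_multiplierIncl_eq [T35Space Y] [LocallyCompactSpace Y] [CompleteSpace V]
    (T : MultiplierModule C₀(Y, ℂ) V) (f : C₀(Y, ℂ))
    (hf : ∀ (a : C₀(Y, ℂ)) (y : Y),
      inner C₀(Y, ℂ) (T a) (T a) y = star (a y) * a y * f y) :
    ∃ x, multiplierIncl C₀(Y, ℂ) V x = T := by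
  have key : ∀ (a : C₀(Y, ℂ)) (C : ℝ), 0 ≤ C → (∀ y, ‖a y‖ ^ 2 * ‖f y‖ ≤ C ^ 2) → ‖T a‖ ≤ C := by
    intro a C hC h
    refine norm_le_of_inner_apply (Y := Y) hC fun y => ?_
    rw [hf, norm_mul, norm_mul, norm_star, ← sq]
    exact h y
  have hex : ∀ n : ℕ, ∃ e : C₀(Y, ℂ), (∀ y, 1 / ((n : ℝ) + 1) ≤ ‖f y‖ → e y = 1) ∧
      ∀ y, ∃ r : ℝ, e y = r ∧ 0 ≤ r ∧ r ≤ 1 := by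
    intro n
    have hpos : (0 : ℝ) < 1 / ((n : ℝ) + 1) := by positivity
    have ht := (zero_at_infty f).norm
    rw [norm_zero] at ht
    obtain ⟨K, hK, hKf⟩ := Filter.mem_cocompact.1 (ht.eventually (gt_mem_nhds hpos))
    obtain ⟨g, hg1, -, hgc, hg01⟩ :=
      exists_continuous_one_zero_of_isCompact hK isClosed_empty (Set.disjoint_empty K)
    refine ⟨⟨⟨fun x => (g x : ℂ), by fun_prop⟩, ?_⟩, fun y hy => ?_, fun y => ?_⟩
    · have h1 : HasCompactSupport (fun x => (g x : ℂ)) := hgc.comp_left (g := Complex.ofReal) rfl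
      exact h1.is_zero_at_infty
    · have hyK : y ∈ K := by
        by_contra hc
        have : ‖f y‖ < 1 / ((n : ℝ) + 1) := hKf hc
        exact absurd hy (not_le.2 this)
      have h1 : g y = 1 := hg1 hyK
      change ((g y : ℝ) : ℂ) = 1
      rw [h1]; simp
    · exact ⟨g y, rfl, (hg01 y).1, (hg01 y).2⟩
  choose e he1 he01 using hex
  have hb : Filter.Tendsto (fun n : ℕ => √(1 / ((n : ℝ) + 1))) Filter.atTop (𝓝 0) := by
    have := (Real.continuous_sqrt.tendsto 0).comp tendsto_one_div_add_atTop_nhds_zero_nat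
    simpa [Function.comp_def] using this
  have hcs : CauchySeq fun n => T (e n) := by
    refine cauchySeq_of_le_tendsto_0 _ (fun n m N hn hm => ?_) hb
    rw [dist_eq_norm]
    have h1 : T (e n) - T (e m) = T (e n - e m) := (map_sub T.1 _ _).symm
    rw [h1]
    refine key _ _ (Real.sqrt_nonneg _) fun y => ?_
    rw [Real.sq_sqrt (by positivity)]
    have hN : ∀ k, N ≤ k → 1 / ((k : ℝ) + 1) ≤ 1 / ((N : ℝ) + 1) := fun k hk => by
      have : (N : ℝ) ≤ k := by exact_mod_cast hk
      gcongr
    by_cases hy : 1 / ((N : ℝ) + 1) ≤ ‖f y‖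
    · have h2 : (e n - e m) y = e n y - e m y := rfl
      rw [h2, he1 n y ((hN n hn).trans hy), he1 m y ((hN m hm).trans hy)]
      have h3 : ‖(1 : ℂ) - 1‖ ^ 2 * ‖f y‖ = 0 := by simp
      rw [h3]
      positivity
    · obtain ⟨r, hr, hr0, hr1⟩ := he01 n y
      obtain ⟨t, ht, ht0, ht1⟩ := he01 m y
      have h2 : (e n - e m) y = ((r - t : ℝ) : ℂ) := by
        change e n y - e m y = _
        rw [hr, ht]; simp
      rw [h2, Complex.norm_real, Real.norm_eq_abs, sq_abs]
      have h3 : (r - t) ^ 2 ≤ 1 := by nlinarith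
      calc (r - t) ^ 2 * ‖f y‖ ≤ 1 * ‖f y‖ := by gcongr
        _ ≤ _ := by rw [one_mul]; exact (not_le.1 hy).le
  obtain ⟨v, hv⟩ := cauchySeq_tendsto_of_complete hcs
  refine ⟨v, multiplier_ext fun a => ?_⟩
  rw [multiplierIncl_apply]
  have hl1 : Filter.Tendsto (fun n => a • T (e n)) Filter.atTop (𝓝 (a • v)) := by
    rw [tendsto_iff_norm_sub_tendsto_zero] at hv ⊢
    refine squeeze_zero (fun _ => norm_nonneg _) (fun n => ?_) (by simpa using hv.mul_const ‖a‖)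
    have h1 : a • T (e n) - a • v = a • (T (e n) - v) :=
      hilbert_ext (A := C₀(Y, ℂ)) fun z => by simp [sub_mul]
    rw [h1]
    exact norm_hilbert_smul_le a _
  have hl2 : Filter.Tendsto (fun n => a • T (e n)) Filter.atTop (𝓝 (T a)) := by
    rw [tendsto_iff_norm_sub_tendsto_zero]
    refine squeeze_zero (fun _ => norm_nonneg _) (fun n => ?_)
      (show Filter.Tendsto (fun n : ℕ => ‖a‖ * √(1 / ((n : ℝ) + 1))) Filter.atTop (𝓝 0) by
        have := hb.const_mul ‖a‖
        rwa [mul_zero] at this)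
    rw [← multiplier_map_mul]
    have h1 : T (a * e n) - T a = T (a * e n - a) := (map_sub T.1 _ _).symm
    rw [h1]
    refine key _ _ (by positivity) fun y => ?_
    rw [mul_pow, Real.sq_sqrt (by positivity)]
    have h2 : (a * e n - a) y = a y * (e n y - 1) := by
      change a y * e n y - a y = _
      ring
    rw [h2, norm_mul, mul_pow, mul_assoc]
    have h4 : ‖e n y - 1‖ ^ 2 * ‖f y‖ ≤ 1 / ((n : ℝ) + 1) := by
      by_cases hy : 1 / ((n : ℝ) + 1) ≤ ‖f y‖
      · rw [he1 n y hy, sub_self, norm_zero]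
        simp only [ne_eq, OfNat.ofNat_ne_zero, not_false_eq_true, zero_pow, zero_mul]
        positivity
      · obtain ⟨r, hr, hr0, hr1⟩ := he01 n y
        have h5 : e n y - 1 = ((r - 1 : ℝ) : ℂ) := by rw [hr]; simp
        rw [h5, Complex.norm_real, Real.norm_eq_abs, sq_abs]
        have h3 : (r - 1) ^ 2 ≤ 1 := by nlinarith
        calc (r - 1) ^ 2 * ‖f y‖ ≤ 1 * ‖f y‖ := by gcongr
          _ ≤ _ := by rw [one_mul]; exact (not_le.1 hy).le
    have h6 := norm_c0_apply_le a y
    gcongr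
  exact tendsto_nhds_unique hl1 hl2

/-- Multiplication of elements of `C₀(Y)` by a function on `βY`. -/
def mulC0 (G : C(StoneCech Y, ℂ)) : C₀(Y, ℂ) →L[ℂ] C₀(Y, ℂ) :=
  LinearMap.mkContinuous
    { toFun := fun a => ⟨⟨fun y => G (stoneCechUnit y) * a y,
        (G.continuous.comp continuous_stoneCechUnit).mul a.continuous⟩, by
          refine squeeze_zero_norm (a := fun y => ‖G‖ * ‖a y‖) (fun y => ?_) ?_
          · change ‖G (stoneCechUnit y) * a y‖ ≤ _
            rw [norm_mul]
            gcongr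
            exact G.norm_coe_le_norm _
          · have := ((zero_at_infty a).norm).const_mul ‖G‖
            simpa using this⟩
      map_add' := fun a b => by
        ext y
        exact mul_add (G (stoneCechUnit y)) (a y) (b y)
      map_smul' := fun c a => by
        ext y
        exact mul_left_comm (G (stoneCechUnit y)) c (a y) } ‖G‖ (fun a => by
      refine norm_c0_le (by positivity) fun y => ?_
      change ‖G (stoneCechUnit y) * a y‖ ≤ _
      rw [norm_mul]
      exact mul_le_mul (G.norm_coe_le_norm _) (norm_c0_apply_le a y) (norm_nonneg _)
        (norm_nonneg _))

theorem mulC0_apply (G : C(StoneCech Y, ℂ)) (a : C₀(Y, ℂ)) (y : Y) :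
    mulC0 G a y = G (stoneCechUnit y) * a y := rfl

/-- The multiplier `G • T`, `(G • T)(a) = T(G a)`. -/
def actionMap (G : C(StoneCech Y, ℂ)) (T : MultiplierModule C₀(Y, ℂ) V) :
    MultiplierModule C₀(Y, ℂ) V :=
  ⟨T.1.comp (mulC0 G), by
    obtain ⟨S, hS⟩ := T.2
    refine ⟨fun x => mulC0 (star G) (S x), fun a x => ?_⟩
    rw [ContinuousLinearMap.comp_apply, hS, WithCStarModule.inner_def,
      WithCStarModule.inner_def]
    ext y
    change S x y * star (G (stoneCechUnit y) * a y) =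
      star (G (stoneCechUnit y)) * S x y * star (a y)
    rw [star_mul]; ring⟩

theorem actionMap_apply (G : C(StoneCech Y, ℂ)) (T : MultiplierModule C₀(Y, ℂ) V)
    (a : C₀(Y, ℂ)) : actionMap G T a = T (mulC0 G a) := rfl

variable (Y V) in
/-- The action of `C(βY)`, the multiplier algebra of `C₀(Y)`, on `M(V)`. -/
def multiplierAction : C(StoneCech Y, ℂ) →+* Module.End ℂ (MultiplierModule C₀(Y, ℂ) V) where
  toFun G :=
    { toFun := actionMap G
      map_add' := fun _ _ => rfl
      map_smul' := fun _ _ => rfl }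
  map_one' := by
    refine LinearMap.ext fun T => multiplier_ext fun a => ?_
    exact congrArg T.1 (ZeroAtInftyContinuousMap.ext fun y => one_mul (a y))
  map_mul' G H := by
    refine LinearMap.ext fun T => multiplier_ext fun a => ?_
    refine congrArg T.1 (ZeroAtInftyContinuousMap.ext fun y => ?_)
    change G (stoneCechUnit y) * H (stoneCechUnit y) * a y =
      H (stoneCechUnit y) * (G (stoneCechUnit y) * a y)
    ring
  map_zero' := by
    refine LinearMap.ext fun T => multiplier_ext fun a => ?_
    have : mulC0 (0 : C(StoneCech Y, ℂ)) a = 0 :=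
      ZeroAtInftyContinuousMap.ext fun y => zero_mul (a y)
    change T (mulC0 0 a) = 0
    rw [this]
    exact map_zero T.1
  map_add' G H := by
    refine LinearMap.ext fun T => multiplier_ext fun a => ?_
    have : mulC0 (G + H) a = mulC0 G a + mulC0 H a :=
      ZeroAtInftyContinuousMap.ext fun y => add_mul _ _ (a y)
    change T (mulC0 (G + H) a) = T (mulC0 G a) + T (mulC0 H a)
    rw [this]
    exact map_add T.1 _ _

theorem multiplierAction_apply (G : C(StoneCech Y, ℂ)) (T : MultiplierModule C₀(Y, ℂ) V)
    (a : C₀(Y, ℂ)) : multiplierAction Y V G T a = T (mulC0 G a) := rfl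

variable [T35Space Y] [LocallyCompactSpace Y] [CompleteSpace V]

theorem multiplierAction_range (G : C(StoneCech Y, ℂ)) :
    LinearMap.range (multiplierIncl C₀(Y, ℂ) V) ≤
      (LinearMap.range (multiplierIncl C₀(Y, ℂ) V)).comap (multiplierAction Y V G) := by
  rintro _ ⟨x, rfl⟩
  refine exists_multiplierIncl_eq _ (mulC0 (star G * G) (inner C₀(Y, ℂ) x x)) fun a y => ?_
  rw [multiplierAction_apply, multiplierIncl_apply, CStarModule.inner_op_smul_right,
    CStarModule.inner_op_smul_left]
  change G (stoneCechUnit y) * a y * (inner C₀(Y, ℂ) x x y * star (G (stoneCechUnit y) * a y)) =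
    star (a y) * a y * (star (G (stoneCechUnit y)) * G (stoneCechUnit y) * inner C₀(Y, ℂ) x x y)
  rw [star_mul]; ring

variable (Y V) in
/-- The action of `C(βY)` on `Q(V)`. -/
def quotientAction : C(StoneCech Y, ℂ) →+* Module.End ℂ (QuotientModule C₀(Y, ℂ) V) where
  toFun G := Submodule.mapQ (LinearMap.range (multiplierIncl C₀(Y, ℂ) V)) _
    (multiplierAction Y V G) (multiplierAction_range G)
  map_one' := by
    refine LinearMap.ext fun q => ?_
    obtain ⟨T, rfl⟩ := toQuotient_surjective q
    change toQuotient _ _ (multiplierAction Y V 1 T) = _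
    rw [map_one]; rfl
  map_mul' G H := by
    refine LinearMap.ext fun q => ?_
    obtain ⟨T, rfl⟩ := toQuotient_surjective q
    change toQuotient _ _ (multiplierAction Y V (G * H) T) = _
    rw [map_mul]; rfl
  map_zero' := by
    refine LinearMap.ext fun q => ?_
    obtain ⟨T, rfl⟩ := toQuotient_surjective q
    change toQuotient _ _ (multiplierAction Y V 0 T) = _
    rw [map_zero]; rfl
  map_add' G H := by
    refine LinearMap.ext fun q => ?_
    obtain ⟨T, rfl⟩ := toQuotient_surjective q
    change toQuotient _ _ (multiplierAction Y V (G + H) T) = _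
    rw [map_add]; rfl

theorem quotientAction_toQuotient (G : C(StoneCech Y, ℂ)) (T : MultiplierModule C₀(Y, ℂ) V) :
    quotientAction Y V G (toQuotient _ _ T) = toQuotient _ _ (actionMap G T) := rfl

theorem ker_coronaRestrict_le :
    RingHom.ker (coronaRestrict : C(StoneCech Y, ℂ) →+* C(Corona Y, ℂ)) ≤
      RingHom.ker (quotientAction Y V) := by
  intro G hG
  obtain ⟨g, hg⟩ := exists_c0_of_coronaRestrict_eq_zero (RingHom.mem_ker.1 hG)
  rw [RingHom.mem_ker]
  refine LinearMap.ext fun q => ?_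
  obtain ⟨T, rfl⟩ := toQuotient_surjective q
  rw [quotientAction_toQuotient, LinearMap.zero_apply, toQuotient_eq_zero_iff]
  refine ⟨T g, multiplier_ext fun a => ?_⟩
  rw [multiplierIncl_apply, actionMap_apply, ← multiplier_map_mul]
  refine congrArg T.1 (ZeroAtInftyContinuousMap.ext fun y => ?_)
  change a y * g y = G (stoneCechUnit y) * a y
  rw [hg]; ring

variable (Y V) in
/-- The action of `C(βY ∖ Y)` on `Q(V)`, induced by the action of `C(βY)` on `M(V)`. -/
def coronaAction : C(Corona Y, ℂ) →+* Module.End ℂ (QuotientModule C₀(Y, ℂ) V) :=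
  RingHom.liftOfSurjective coronaRestrict coronaRestrict_surjective
    ⟨quotientAction Y V, ker_coronaRestrict_le⟩

/-- `Q(V)` as a module over `C(βY ∖ Y)`. -/
instance instModuleQuotientModule : Module C(Corona Y, ℂ) (QuotientModule C₀(Y, ℂ) V) :=
  Module.compHom _ (coronaAction Y V)

theorem coronaRestrict_smul_toQuotient (G : C(StoneCech Y, ℂ))
    (T : MultiplierModule C₀(Y, ℂ) V) :
    coronaRestrict G • toQuotient _ _ T = toQuotient _ _ (actionMap G T) := by
  have h : coronaAction Y V (coronaRestrict G) = quotientAction Y V G :=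
    RingHom.liftOfRightInverse_comp_apply _ _ _ _ _
  change coronaAction Y V (coronaRestrict G) (toQuotient _ _ T) = _
  rw [h, quotientAction_toQuotient]

/-- Existence of the multiplier `⟨T, S⟩ = T* S`. -/
theorem exists_multiplierInner (T S : MultiplierModule C₀(Y, ℂ) V) :
    ∃ G : C(StoneCech Y, ℂ), ∀ (a b : C₀(Y, ℂ)) (y : Y),
      inner C₀(Y, ℂ) (T a) (S b) y = star (a y) * G (stoneCechUnit y) * b y := by
  choose u hu1 hu2 using fun y : Y => exists_local_unit y
  let h : Y → ℂ := fun y => inner C₀(Y, ℂ) (T (u y)) (S (u y)) y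
  have key : ∀ (a b : C₀(Y, ℂ)) (y : Y),
      inner C₀(Y, ℂ) (T a) (S b) y = star (a y) * h y * b y := by
    intro a b y
    have h1 : u y y = 1 := (hu1 y).self_of_nhds
    have h2 : inner C₀(Y, ℂ) (T (u y * a)) (S (u y * b)) y
        = u y y * (inner C₀(Y, ℂ) (T a) (S b) y * star (u y y)) := by
      rw [multiplier_map_mul, multiplier_map_mul, CStarModule.inner_op_smul_right,
        CStarModule.inner_op_smul_left]
      rfl
    have h3 : inner C₀(Y, ℂ) (T (u y * a)) (S (u y * b)) y = b y * (h y * star (a y)) := by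
      rw [mul_comm (u y) a, mul_comm (u y) b, multiplier_map_mul, multiplier_map_mul,
        CStarModule.inner_op_smul_right, CStarModule.inner_op_smul_left]
      rfl
    rw [h3, h1] at h2
    simp only [star_one, mul_one, one_mul] at h2
    rw [← h2]; ring
  have hc : Continuous h := by
    rw [continuous_iff_continuousAt]
    intro y
    have h1 : ContinuousAt (fun x => inner C₀(Y, ℂ) (T (u y)) (S (u y)) x) y :=
      (inner C₀(Y, ℂ) (T (u y)) (S (u y))).continuous.continuousAt
    refine h1.congr ?_
    filter_upwards [hu1 y] with x hx
    rw [key, hx]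
    simp
  obtain ⟨G, hG⟩ := exists_stoneCech_extension h hc (‖T.1‖ * ‖S.1‖) fun y => by
    refine (norm_c0_apply_le _ y).trans ((CStarModule.norm_inner_le V).trans ?_)
    have h1 : ‖T (u y)‖ ≤ ‖T.1‖ := (T.1.le_opNorm _).trans
      (mul_le_of_le_one_right (norm_nonneg _) (hu2 y))
    have h2 : ‖S (u y)‖ ≤ ‖S.1‖ := (S.1.le_opNorm _).trans
      (mul_le_of_le_one_right (norm_nonneg _) (hu2 y))
    gcongr
  exact ⟨G, fun a b y => by rw [key, hG]⟩

/-- The `C(βY)`-valued inner product on `M(V)`: `⟨T, S⟩ = T* S` is the multiplier of `C₀(Y)`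
determined by `⟨T a, S b⟩ = a* ⟨T, S⟩ b`. -/
def multiplierInner (T S : MultiplierModule C₀(Y, ℂ) V) : C(StoneCech Y, ℂ) :=
  (exists_multiplierInner T S).choose

theorem multiplierInner_spec (T S : MultiplierModule C₀(Y, ℂ) V) (a b : C₀(Y, ℂ)) (y : Y) :
    inner C₀(Y, ℂ) (T a) (S b) y =
      star (a y) * multiplierInner T S (stoneCechUnit y) * b y :=
  (exists_multiplierInner T S).choose_spec a b y

theorem multiplierInner_eq {T S : MultiplierModule C₀(Y, ℂ) V} {G : C(StoneCech Y, ℂ)}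
    (h : ∀ (a b : C₀(Y, ℂ)) (y : Y),
      inner C₀(Y, ℂ) (T a) (S b) y = star (a y) * G (stoneCechUnit y) * b y) :
    multiplierInner T S = G := by
  refine stoneCech_ext fun y => ?_
  obtain ⟨u, hu, -⟩ := exists_local_unit y
  have h1 := multiplierInner_spec T S u u y
  rw [h, hu.self_of_nhds] at h1
  simpa using h1.symm

theorem multiplierInner_add_right (T S S' : MultiplierModule C₀(Y, ℂ) V) :
    multiplierInner T (S + S') = multiplierInner T S + multiplierInner T S' :=
  multiplierInner_eq fun a b y => by
    rw [multiplier_add_apply, CStarModule.inner_add_right, ZeroAtInftyContinuousMap.add_apply,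
      multiplierInner_spec, multiplierInner_spec, ContinuousMap.add_apply]
    ring

theorem star_multiplierInner (T S : MultiplierModule C₀(Y, ℂ) V) :
    star (multiplierInner T S) = multiplierInner S T :=
  (multiplierInner_eq fun a b y => by
    rw [← CStarModule.star_inner, ZeroAtInftyContinuousMap.star_apply, multiplierInner_spec,
      ContinuousMap.star_apply]
    simp only [star_mul, star_star]
    ring).symm

theorem coronaRestrict_inner_multiplierIncl (T : MultiplierModule C₀(Y, ℂ) V) (x : V) :
    coronaRestrict (multiplierInner T (multiplierIncl _ V x)) = 0 := by
  obtain ⟨S, hS⟩ := T.2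
  refine coronaRestrict_eq_zero (S x) fun y => ?_
  obtain ⟨u, hu, -⟩ := exists_local_unit y
  have h1 := multiplierInner_spec T (multiplierIncl _ V x) u u y
  rw [multiplierIncl_apply, CStarModule.inner_op_smul_right, hS, WithCStarModule.inner_def] at h1
  have h2 : (u * (S x * star u)) y = u y * (S x y * star (u y)) := rfl
  rw [h2, hu.self_of_nhds] at h1
  simpa using h1.symm

theorem coronaRestrict_inner_congr_right (T : MultiplierModule C₀(Y, ℂ) V)
    {S S' : MultiplierModule C₀(Y, ℂ) V} (h : toQuotient _ _ S = toQuotient _ _ S') :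
    coronaRestrict (multiplierInner T S) = coronaRestrict (multiplierInner T S') := by
  rw [← sub_eq_zero, ← map_sub, toQuotient_eq_zero_iff] at h
  obtain ⟨x, hx⟩ := h
  have h1 : S = S' + multiplierIncl _ V x := by rw [hx]; abel
  rw [h1, multiplierInner_add_right, map_add, coronaRestrict_inner_multiplierIncl, add_zero]

theorem coronaRestrict_star (G : C(StoneCech Y, ℂ)) :
    coronaRestrict (star G) = star (coronaRestrict G) := rfl

theorem coronaRestrict_inner_congr {T T' S S' : MultiplierModule C₀(Y, ℂ) V}
    (hT : toQuotient _ _ T = toQuotient _ _ T') (hS : toQuotient _ _ S = toQuotient _ _ S') :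
    coronaRestrict (multiplierInner T S) = coronaRestrict (multiplierInner T' S') := by
  rw [coronaRestrict_inner_congr_right T hS, ← star_multiplierInner S' T, coronaRestrict_star,
    coronaRestrict_inner_congr_right S' hT, ← coronaRestrict_star, star_multiplierInner]

/-- The `C(βY ∖ Y)`-valued inner product on `Q(V)`, induced by that of `M(V)`. -/
instance instInnerQuotientModule : Inner C(Corona Y, ℂ) (QuotientModule C₀(Y, ℂ) V) where
  inner p q := Quotient.liftOn₂' p q (fun T S => coronaRestrict (multiplierInner T S))
    (fun _ _ _ _ hT hS => coronaRestrict_inner_congr (Quotient.sound' hT) (Quotient.sound' hS))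

theorem inner_toQuotient (T S : MultiplierModule C₀(Y, ℂ) V) :
    inner C(Corona Y, ℂ) (toQuotient _ _ T) (toQuotient _ _ S) =
      coronaRestrict (multiplierInner T S) := rfl

end Commutative

/-! ### Extensions -/

section Extensions

variable {X : Type u} [TopologicalSpace X] [CompactSpace X] [T2Space X]

instance instLocallyCompactOpens (U : TopologicalSpace.Opens X) : LocallyCompactSpace U :=
  U.isOpen.locallyCompactSpace

variable (U : TopologicalSpace.Opens X)

/-- The inclusion `φ : C₀(U) → C(X)`, extension by zero. -/
def extendByZero (f : C₀(U, ℂ)) : C(X, ℂ) where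
  toFun x := open Classical in if h : x ∈ U then f ⟨x, h⟩ else 0
  continuous_toFun := by
    classical
    rw [continuous_iff_continuousAt]
    intro x
    by_cases hx : x ∈ U
    · have h1 : ContinuousAt ((fun x => if h : x ∈ U then f ⟨x, h⟩ else 0) ∘
          (Subtype.val : U → X)) ⟨x, hx⟩ := by
        have : ((fun x => if h : x ∈ U then f ⟨x, h⟩ else 0) ∘ (Subtype.val : U → X)) = f := by
          funext y
          simp
        rw [this]
        exact f.continuous.continuousAt
      exact (U.isOpen.isOpenEmbedding_subtypeVal.continuousAt_iff (x := ⟨x, hx⟩)).1 h1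
    · rw [Metric.continuousAt_iff']
      intro ε hε
      have ht := (zero_at_infty f).norm
      rw [norm_zero] at ht
      obtain ⟨K, hK, hKf⟩ := Filter.mem_cocompact.1 (ht.eventually (gt_mem_nhds hε))
      have hKc : IsClosed (Subtype.val '' K : Set X) :=
        (hK.image continuous_subtype_val).isClosed
      have hxK : x ∈ (Subtype.val '' K : Set X)ᶜ := by
        rintro ⟨y, -, rfl⟩
        exact hx y.2
      filter_upwards [hKc.isOpen_compl.mem_nhds hxK] with z hz
      rw [dif_neg hx, dist_zero_right]
      split_ifs with hzU
      · exact hKf (a := ⟨z, hzU⟩) fun hzK => hz ⟨_, hzK, rfl⟩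
      · simpa using hε

theorem extendByZero_apply_mem (f : C₀(U, ℂ)) (y : U) : extendByZero U f y = f y := by
  simp [extendByZero]

theorem extendByZero_apply_notMem (f : C₀(U, ℂ)) {x : X} (hx : x ∉ U) :
    extendByZero U f x = 0 := by
  simp [extendByZero, hx]

/-- The boundary `∂U`. -/
abbrev Boundary : Type u := ↥(frontier (U : Set X))

instance instCompactSpaceBoundary : CompactSpace (Boundary U) :=
  isCompact_iff_compactSpace.1 isClosed_frontier.isCompact

/-- The quotient map `π : C(X) → C(∂U)`, restriction of functions. -/
def boundaryRestrict (g : C(X, ℂ)) : C(Boundary U, ℂ) := g.restrict _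

/-- The extension `βU → X` of the inclusion `U → X`. -/
def stoneCechMap : C(StoneCech U, X) :=
  ⟨stoneCechExtend (continuous_subtype_val : Continuous (Subtype.val : U → X)),
    continuous_stoneCechExtend _⟩

theorem stoneCechMap_unit (y : U) : stoneCechMap U (stoneCechUnit y) = y :=
  stoneCechExtend_stoneCechUnit continuous_subtype_val y

theorem stoneCechMap_mem_frontier (p : Corona U) :
    stoneCechMap U p.1 ∈ frontier (U : Set X) := by
  have hcl : stoneCechMap U p.1 ∈ closure (U : Set X) := by
    have h1 : p.1 ∈ closure (Set.range (stoneCechUnit : U → StoneCech U)) :=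
      denseRange_stoneCechUnit p.1
    refine closure_minimal (t := stoneCechMap U ⁻¹' closure (U : Set X)) ?_
      (isClosed_closure.preimage (stoneCechMap U).continuous) h1
    rintro _ ⟨y, rfl⟩
    rw [Set.mem_preimage, stoneCechMap_unit]
    exact subset_closure y.2
  rw [frontier, U.isOpen.interior_eq]
  refine ⟨hcl, fun hU => ?_⟩
  obtain ⟨u, hu, -⟩ := exists_local_unit (⟨_, hU⟩ : U)
  have h0 := coronaRestrict_eq_zero
    (G := (extendByZero U u).comp (stoneCechMap U)) u fun y => by
      rw [ContinuousMap.comp_apply, stoneCechMap_unit, extendByZero_apply_mem]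
  have h1 : extendByZero U u (stoneCechMap U p.1) = 0 := DFunLike.congr_fun h0 p
  have h2 := extendByZero_apply_mem U u ⟨_, hU⟩
  rw [hu.self_of_nhds] at h2
  exact one_ne_zero (h2.symm.trans h1)

/-- The map `βU ∖ U → ∂U` extending the identity of `U`; composition with it is
`δ : C(∂U) → C(βU ∖ U)`, the Busby invariant of the extension
`0 → C₀(U) → C(X) → C(∂U) → 0`. -/
def coronaMap : C(Corona U, Boundary U) where
  toFun p := ⟨stoneCechMap U p.1, stoneCechMap_mem_frontier U p⟩
  continuous_toFun := ((stoneCechMap U).continuous.comp continuous_subtype_val).subtype_mk _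

variable (V : Type v) [NormedAddCommGroup V] [NormedSpace ℂ V] [SMul C₀(U, ℂ) V]
  [CStarModule C₀(U, ℂ) V]
variable (Z : Type w) [NormedAddCommGroup Z] [NormedSpace ℂ Z] [Module C(Boundary U, ℂ) Z]
  [CStarModule C(Boundary U, ℂ) Z]

/-- A Hilbert C*-module extension `0 → V → W → Z → 0` with underlying C*-algebra extension
`0 → C₀(U) → C(X) → C(∂U) → 0`: a Hilbert C*-module `W` over `C(X)`, a `φ`-morphism
`incl : V → W` and a `π`-morphism `proj : W → Z` that form a short exact sequence. -/
structure Extension where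
  W : Type (max u v w)
  [normedAddCommGroup : NormedAddCommGroup W]
  [normedSpace : NormedSpace ℂ W]
  [module : Module C(X, ℂ) W]
  [cstarModule : CStarModule C(X, ℂ) W]
  [completeSpace : CompleteSpace W]
  incl : V →ₗ[ℂ] W
  inner_incl : ∀ x x' : V,
    inner C(X, ℂ) (incl x) (incl x') = extendByZero U (inner C₀(U, ℂ) x x')
  proj : W →ₗ[ℂ] Z
  inner_proj : ∀ y y' : W,
    inner C(Boundary U, ℂ) (proj y) (proj y') = boundaryRestrict U (inner C(X, ℂ) y y')
  injective_incl : Function.Injective incl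
  exact_incl_proj : Function.Exact incl proj
  surjective_proj : Function.Surjective proj

attribute [instance] Extension.normedAddCommGroup Extension.normedSpace Extension.module
  Extension.cstarModule Extension.completeSpace

/-- A continuous function on `X` that vanishes outside `U` restricts to an element of `C₀(U)`. -/
theorem exists_c0_of_vanishing {g : C(X, ℂ)} (hg : ∀ x, x ∉ U → g x = 0) :
    ∃ f : C₀(U, ℂ), ∀ y : U, f y = g y := by
  refine ⟨⟨⟨fun y => g y, by fun_prop⟩, ?_⟩, fun _ => rfl⟩
  change Filter.Tendsto (fun y : U => g y) _ _
  rw [Metric.tendsto_nhds]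
  intro ε hε
  have hc : IsCompact {x : X | ε ≤ ‖g x‖} :=
    (isClosed_le continuous_const (by fun_prop)).isCompact
  have hsub : {x : X | ε ≤ ‖g x‖} ⊆ Set.range (Subtype.val : U → X) := by
    intro x hx
    rw [Subtype.range_coe]
    by_contra hxU
    rw [Set.mem_ofPred_eq, hg x hxU, norm_zero] at hx
    exact absurd hx (not_le.2 hε)
  refine Filter.mem_cocompact.2
    ⟨_, (IsEmbedding.subtypeVal.isInducing.isCompact_preimage_iff hsub).2 hc, ?_⟩
  intro y hy
  have : ¬ ε ≤ ‖g y‖ := hy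
  simpa using this

variable {U V Z}

theorem extendByZero_ext {f : C₀(U, ℂ)} {g : C(X, ℂ)} (h : ∀ y : U, g y = f y)
    (h' : ∀ x, x ∉ U → g x = 0) : extendByZero U f = g := by
  ext x
  by_cases hx : x ∈ U
  · rw [extendByZero_apply_mem U f ⟨x, hx⟩, ← h ⟨x, hx⟩]
  · rw [extendByZero_apply_notMem U f hx, h' x hx]

theorem extendByZero_injective : Function.Injective (extendByZero U) := fun f g h => by
  ext y
  rw [← extendByZero_apply_mem, h, extendByZero_apply_mem]

theorem norm_extendByZero (f : C₀(U, ℂ)) : ‖extendByZero U f‖ = ‖f‖ := by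
  refine le_antisymm ((ContinuousMap.norm_le _ (norm_nonneg _)).2 fun x => ?_)
    (norm_c0_le (norm_nonneg _) fun y => ?_)
  · by_cases hx : x ∈ U
    · rw [extendByZero_apply_mem U f ⟨x, hx⟩]
      exact norm_c0_apply_le f _
    · rw [extendByZero_apply_notMem U f hx, norm_zero]
      exact norm_nonneg _
  · rw [← extendByZero_apply_mem]
    exact ContinuousMap.norm_coe_le_norm _ _

theorem extendByZero_mul (f g : C₀(U, ℂ)) :
    extendByZero U (f * g) = extendByZero U f * extendByZero U g := by
  refine extendByZero_ext (fun q => ?_) fun p hp => ?_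
  · rw [ContinuousMap.mul_apply, extendByZero_apply_mem, extendByZero_apply_mem]; rfl
  · rw [ContinuousMap.mul_apply, extendByZero_apply_notMem U _ hp, zero_mul]

theorem extendByZero_star (f : C₀(U, ℂ)) :
    extendByZero U (star f) = star (extendByZero U f) := by
  refine extendByZero_ext (fun q => ?_) fun p hp => ?_
  · rw [ContinuousMap.star_apply, extendByZero_apply_mem]; rfl
  · rw [ContinuousMap.star_apply, extendByZero_apply_notMem U _ hp, star_zero]

theorem extendByZero_add (f g : C₀(U, ℂ)) :
    extendByZero U (f + g) = extendByZero U f + extendByZero U g := by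
  refine extendByZero_ext (fun q => ?_) fun p hp => ?_
  · rw [ContinuousMap.add_apply, extendByZero_apply_mem, extendByZero_apply_mem]; rfl
  · rw [ContinuousMap.add_apply, extendByZero_apply_notMem U _ hp,
      extendByZero_apply_notMem U _ hp, add_zero]

theorem extendByZero_smul (c : ℂ) (f : C₀(U, ℂ)) :
    extendByZero U (c • f) = c • extendByZero U f := by
  refine extendByZero_ext (fun q => ?_) fun p hp => ?_
  · rw [ContinuousMap.smul_apply, extendByZero_apply_mem]; rfl
  · rw [ContinuousMap.smul_apply, extendByZero_apply_notMem U _ hp, smul_zero]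

variable [CompleteSpace V] (E : Extension U V Z)

theorem Extension.incl_smul (a : C₀(U, ℂ)) (x : V) :
    E.incl (a • x) = extendByZero U a • E.incl x := by
  rw [← sub_eq_zero, ← CStarModule.inner_self (A := C(X, ℂ))]
  simp only [CStarModule.inner_sub_left, CStarModule.inner_sub_right,
    CStarModule.inner_op_smul_left, CStarModule.inner_op_smul_right, E.inner_incl,
    extendByZero_mul, extendByZero_star]
  ring

theorem Extension.inner_incl_apply_notMem (y : E.W) (x : V) {p : X} (hp : p ∉ U) :
    inner C(X, ℂ) y (E.incl x) p = 0 := by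
  have h1 : inner C(X, ℂ) y (E.incl x) * inner C(X, ℂ) (E.incl x) y ≤
      ‖y‖ ^ 2 • inner C(X, ℂ) (E.incl x) (E.incl x) := CStarModule.inner_mul_inner_swap_le
  have h2 : (inner C(X, ℂ) y (E.incl x) * inner C(X, ℂ) (E.incl x) y) p ≤
      (‖y‖ ^ 2 • inner C(X, ℂ) (E.incl x) (E.incl x)) p := h1 p
  have h3 : (‖y‖ ^ 2 • inner C(X, ℂ) (E.incl x) (E.incl x)) p =
      ‖y‖ ^ 2 • inner C(X, ℂ) (E.incl x) (E.incl x) p := rfl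
  rw [h3, E.inner_incl, extendByZero_apply_notMem U _ hp, smul_zero, ContinuousMap.mul_apply,
    ← CStarModule.star_inner y, ContinuousMap.star_apply] at h2
  have h4 : (0 : ℂ) ≤ inner C(X, ℂ) y (E.incl x) p * star (inner C(X, ℂ) y (E.incl x) p) :=
    mul_star_self_nonneg _
  have h5 := le_antisymm h2 h4
  simpa using h5

theorem Extension.exists_incl_eq (y : E.W) (a : C₀(U, ℂ)) :
    ∃ x : V, E.incl x = extendByZero U a • y := by
  refine (E.exact_incl_proj _).1 ?_
  rw [← CStarModule.inner_self (A := C(Boundary U, ℂ)), E.inner_proj]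
  ext p
  have hp : p.1 ∉ U := fun h => by
    have h2 : p.1 ∈ closure (U : Set X) \ interior (U : Set X) := p.2
    rw [U.isOpen.interior_eq] at h2
    exact h2.2 h
  change inner C(X, ℂ) (extendByZero U a • y) (extendByZero U a • y) p.1 = 0
  rw [CStarModule.inner_op_smul_right, ContinuousMap.mul_apply,
    extendByZero_apply_notMem U a hp, zero_mul]

theorem Extension.norm_incl (x : V) : ‖E.incl x‖ = ‖x‖ := by
  rw [CStarModule.norm_eq_sqrt_norm_inner_self (A := C(X, ℂ)), E.inner_incl, norm_extendByZero,
    ← CStarModule.norm_eq_sqrt_norm_inner_self]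

/-- Every `y : W` defines a multiplier `a ↦ a • y ∈ V`. -/
theorem Extension.exists_toMultiplier (y : E.W) :
    ∃ T : MultiplierModule C₀(U, ℂ) V, ∀ a, E.incl (T a) = extendByZero U a • y := by
  choose t ht using E.exists_incl_eq y
  choose S hS using fun x : V => exists_c0_of_vanishing U
    (g := inner C(X, ℂ) y (E.incl x)) fun p hp => E.inner_incl_apply_notMem y x hp
  have hS' : ∀ x, extendByZero U (S x) = inner C(X, ℂ) y (E.incl x) := fun x =>
    extendByZero_ext (fun q => (hS x q).symm) fun p hp => E.inner_incl_apply_notMem y x hp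
  refine ⟨⟨LinearMap.mkContinuous
    { toFun := t
      map_add' := fun a b => E.injective_incl ?_
      map_smul' := fun c a => E.injective_incl ?_ } ‖y‖ fun a => ?_, S, fun a x => ?_⟩, ht⟩
  · rw [map_add, ht, ht, ht, extendByZero_add, add_smul]
  · rw [RingHom.id_apply, map_smul, ht, ht, extendByZero_smul]
    refine hilbert_ext (A := C(X, ℂ)) fun z => ?_
    rw [CStarModule.inner_smul_left_complex, CStarModule.inner_op_smul_left,
      CStarModule.inner_op_smul_left, star_smul, mul_smul_comm]
  · change ‖t a‖ ≤ _
    rw [← E.norm_incl, ht, ← norm_extendByZero a]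
    exact norm_hilbert_smul_le _ _
  · change inner C₀(U, ℂ) (t a) x = _
    refine extendByZero_injective ?_
    rw [← E.inner_incl, ht, WithCStarModule.inner_def, extendByZero_mul, hS', extendByZero_star,
      CStarModule.inner_op_smul_left]

/-- The map `Λ : W → M(V)`, `Λ(y)(a) = a • y`. -/
def Extension.toMultiplier (y : E.W) : MultiplierModule C₀(U, ℂ) V :=
  (E.exists_toMultiplier y).choose

theorem Extension.incl_toMultiplier (y : E.W) (a : C₀(U, ℂ)) :
    E.incl (E.toMultiplier y a) = extendByZero U a • y :=
  (E.exists_toMultiplier y).choose_spec a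

theorem Extension.toMultiplier_eq_of_incl {y : E.W} {T : MultiplierModule C₀(U, ℂ) V}
    (h : ∀ a, E.incl (T a) = extendByZero U a • y) : E.toMultiplier y = T :=
  multiplier_ext fun a => E.injective_incl <| by rw [E.incl_toMultiplier, h]

theorem multiplierInner_toMultiplier (y y' : E.W) :
    multiplierInner (E.toMultiplier y) (E.toMultiplier y') =
      (inner C(X, ℂ) y y').comp (stoneCechMap U) :=
  multiplierInner_eq fun a b q => by
    rw [← extendByZero_apply_mem, ← E.inner_incl, E.incl_toMultiplier, E.incl_toMultiplier,
      CStarModule.inner_op_smul_right, CStarModule.inner_op_smul_left, ContinuousMap.mul_apply,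
      ContinuousMap.mul_apply, ContinuousMap.star_apply, extendByZero_apply_mem,
      extendByZero_apply_mem, ContinuousMap.comp_apply, stoneCechMap_unit]
    ring

theorem Extension.toQuotient_congr {y y' : E.W} (h : E.proj y = E.proj y') :
    toQuotient C₀(U, ℂ) V (E.toMultiplier y) = toQuotient C₀(U, ℂ) V (E.toMultiplier y') := by
  rw [← sub_eq_zero, ← map_sub] at h
  obtain ⟨x, hx⟩ := (E.exact_incl_proj _).1 h
  rw [← sub_eq_zero, ← map_sub, toQuotient_eq_zero_iff]
  refine ⟨x, multiplier_ext fun a => E.injective_incl ?_⟩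
  rw [multiplierIncl_apply, multiplier_sub_apply, map_sub, E.incl_toMultiplier,
    E.incl_toMultiplier, E.incl_smul, hx, smul_sub]

variable (U V Z) in
/-- The Hilbert C*-module morphisms `Δ : Z → Q(V)` over `δ : C(∂U) → C(βU ∖ U)`, with the topology
of pointwise convergence in norm. -/
abbrev BusbyMorphism : Type max u v w :=
  {Δ : Z → QuotientModule C₀(U, ℂ) V // ∀ z z' : Z,
    inner C(Corona U, ℂ) (Δ z) (Δ z') = (inner C(Boundary U, ℂ) z z').comp (coronaMap U)}

/-- The Busby invariant `Δ : Z → Q(V)` of an extension: `Δ ∘ proj = Σ ∘ Λ`. -/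
def Extension.busby : BusbyMorphism U V Z :=
  ⟨fun z => toQuotient C₀(U, ℂ) V (E.toMultiplier (E.surjective_proj z).choose), fun z z' => by
    rw [inner_toQuotient, multiplierInner_toMultiplier]
    have h := E.inner_proj (E.surjective_proj z).choose (E.surjective_proj z').choose
    rw [(E.surjective_proj z).choose_spec, (E.surjective_proj z').choose_spec] at h
    rw [h]
    rfl⟩

theorem Extension.busby_proj (y : E.W) :
    E.busby.1 (E.proj y) = toQuotient C₀(U, ℂ) V (E.toMultiplier y) :=
  E.toQuotient_congr (E.surjective_proj (E.proj y)).choose_spec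

variable (U V Z) in
/-- Homotopy of extensions: the Busby invariants are joined by a path `t ↦ Δ_t` of Hilbert
C*-module morphisms such that `t ↦ Δ_t(z)` is norm continuous for every `z`. -/
def homotopySetoid : Setoid (Extension U V Z) :=
  (pathSetoid (BusbyMorphism U V Z)).comap Extension.busby

variable (U V Z) in
/-- The set of homotopy classes of extensions of `Z` by `V`. -/
def ExtensionClasses : Type _ := Quotient (homotopySetoid U V Z)

/-- The homotopy class of an extension. -/
def Extension.homotopyClass : ExtensionClasses U V Z := Quotient.mk (homotopySetoid U V Z) E

end Extensions

/-! ### Homotopy classes of maps to the Stiefel manifold -/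

section Stiefel

/-- The Stiefel manifold `V_{k,m}` of orthonormal `k`-frames in `ℂ^m`. -/
abbrev Stiefel (k m : ℕ) : Type :=
  {v : Fin k → EuclideanSpace ℂ (Fin m) // Orthonormal ℂ v}

variable (K : Type*) (L : Type*) [TopologicalSpace K] [TopologicalSpace L]

/-- Homotopy of continuous maps, as an equivalence relation. -/
def mapsSetoid : Setoid C(K, L) := ⟨ContinuousMap.Homotopic, ContinuousMap.Homotopic.equivalence⟩

/-- The set `[K, L]` of homotopy classes of continuous maps. -/
def HomotopyClasses : Type _ := Quotient (mapsSetoid K L)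

variable {K L}

/-- The homotopy class of a continuous map. -/
def mapClass (f : C(K, L)) : HomotopyClasses K L := Quotient.mk (mapsSetoid K L) f

end Stiefel

end HilbertModuleExtensions

end

open HilbertModuleExtensions

set_option linter.unusedSectionVars false

noncomputable section

namespace HilbertModuleExtensions

universe u v w

/-! ### Orthonormal bases of free Hilbert modules over `C(K, ℂ)` -/

section Orthonormal

variable {K : Type*} [TopologicalSpace K] [CompactSpace K]
variable {H : Type*} [NormedAddCommGroup H] [NormedSpace ℂ H] [Module C(K, ℂ) H]
  [CStarModule C(K, ℂ) H]

/-! Homotopy of extensions is defined through Busby invariants, so the theorem splits into two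
claims: every `δ`-morphism `Z → Q(V)` is the Busby invariant of some extension, and the path
components of the space of `δ`-morphisms are the homotopy classes of maps from the corona to the
Stiefel manifold.

For the first claim, take `W` to be the pullback of `M(V)` and `Z` over `Q(V)`. Its inner products
have a component in `C(βU)` and one in `C(∂U)` that agree on the corona. Since `U` is dense, `βU →
X` is a quotient map, and such a compatible pair is the same thing as one function on `X`
(`exists_comp_stoneCechMap_eq`). The multiplier of `(T, z)` is then `T` itself, so the Busby
invariant is the given morphism (`busby_pullbackExtension`).

For the second claim, free Hilbert modules over `C(K)` have orthonormal bases
(`exists_orthonormal_basis`). Preservation of inner products makes a `δ`-morphism determined by the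
images of the basis of `Z` (`BusbyMorphism.apply_eq_sum`). These images are `k` orthonormal vectors
in a free module of rank `m`, that is, an orthonormal `k`-frame in `ℂ^m` at each point of the
corona, varying continuously (`BusbyMorphism.frameEquiv`). Pointwise norm continuity of a path of
morphisms amounts to sup-norm continuity of the finitely many matrix entries, which on the compact
corona is joint continuity, hence homotopy (`BusbyMorphism.joined_iff_homotopic`).

All of this needs `Q(V)` to be a genuine Hilbert module over the corona algebra. The main point
there is that the quotient norm is the one given by the inner product (`norm_sq_toQuotient`). -/

theorem algebraMap_smul_hilbert (c : ℂ) (x : H) :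
    (algebraMap ℂ C(K, ℂ) c) • x = c • x := by
  -- The actions of `ℂ` and of `C(K)` are separate data; they are compatible because both sides have
  -- the same inner product with every `z`.
  refine hilbert_ext (A := C(K, ℂ)) fun z => ?_
  rw [CStarModule.inner_smul_left_complex, CStarModule.inner_op_smul_left,
    Algebra.algebraMap_eq_smul_one, star_smul, star_one, mul_smul_comm, mul_one]

theorem complex_smul_smul (c : ℂ) (a : C(K, ℂ)) (x : H) : (c • a) • x = c • a • x := by
  rw [← algebraMap_smul_hilbert (K := K) c (a • x), smul_smul, Algebra.algebraMap_eq_smul_one,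
    smul_mul_assoc, one_mul]

theorem continuous_smul_right (x : H) : Continuous fun a : C(K, ℂ) => a • x := by
  refine (LipschitzWith.of_dist_le_mul (K := ‖x‖₊) fun a b => ?_).continuous
  rw [dist_eq_norm, dist_eq_norm, ← sub_smul]
  exact norm_hilbert_smul_le _ _

/-- The coordinates with respect to a basis of a Hilbert module are bounded. -/
theorem exists_norm_repr_le [CompleteSpace H] {n : ℕ} (b : Module.Basis (Fin n) C(K, ℂ) H) :
    ∃ C : ℝ, ∀ x i, ‖b.repr x i‖ ≤ C * ‖x‖ := by
  let φ : (Fin n → C(K, ℂ)) ≃ₗ[ℂ] H :=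
    { b.equivFun.symm.toAddEquiv with
      map_smul' := fun c a => by
        change b.equivFun.symm (c • a) = c • b.equivFun.symm a
        simp only [Module.Basis.equivFun_symm_apply, Pi.smul_apply, complex_smul_smul,
          Finset.smul_sum] }
  have hφ : Continuous φ := by
    have : (φ : (Fin n → C(K, ℂ)) → H) = fun a => ∑ i, a i • b i :=
      funext fun a => b.equivFun_symm_apply a
    rw [this]
    exact continuous_finsetSum _ fun i _ => (continuous_smul_right (b i)).comp (continuous_apply i)
  -- Open mapping theorem: a continuous linear bijection of Banach spaces has a bounded inverse.
  let ψ := φ.toContinuousLinearEquivOfContinuous hφ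
  refine ⟨‖(ψ.symm : H →L[ℂ] (Fin n → C(K, ℂ)))‖, fun x i => ?_⟩
  have h1 : b.repr x i = ψ.symm x i := by
    obtain ⟨a, rfl⟩ := ψ.surjective x
    rw [ψ.symm_apply_apply]
    have : ψ a = b.equivFun.symm a := rfl
    rw [this, ← b.equivFun_apply, LinearEquiv.apply_symm_apply]
  rw [h1]
  exact (norm_le_pi_norm _ i).trans ((ψ.symm : H →L[ℂ] (Fin n → C(K, ℂ))).le_opNorm x)

/-- If the inner square of `b i` vanished at `p`, a bump function `h` concentrated near its zeros,
with `h p = 1`, would make `h • b i` short, although its `i`-th coordinate `h` has norm at least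
one. This contradicts the boundedness of coordinates. Gram–Schmidt needs the non-vanishing in order
to normalise. -/
theorem inner_basis_self_apply_ne_zero [CompleteSpace H] {n : ℕ}
    (b : Module.Basis (Fin n) C(K, ℂ) H) (i : Fin n) (p : K) :
    inner C(K, ℂ) (b i) (b i) p ≠ 0 := by
  intro h0
  obtain ⟨C, hC⟩ := exists_norm_repr_le b
  set g : C(K, ℂ) := inner C(K, ℂ) (b i) (b i) with hg
  -- Chosen so that `C ^ 2 * ε < 1`; the bump function below gives `1 ≤ C ^ 2 * ε`.
  set ε : ℝ := 1 / (C ^ 2 + 1) with hε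
  have hε0 : 0 < ε := by positivity
  let h : C(K, ℂ) := ⟨fun q => ((max 0 (1 - ‖g q‖ / ε) : ℝ) : ℂ), by fun_prop⟩
  have hq : ∀ q, ‖h q‖ = max 0 (1 - ‖g q‖ / ε) := fun q => by
    change ‖((max 0 (1 - ‖g q‖ / ε) : ℝ) : ℂ)‖ = _
    rw [Complex.norm_real, Real.norm_eq_abs, abs_of_nonneg (le_max_left _ _)]
  have hp : ‖h p‖ = 1 := by rw [hq, h0]; simp
  have h1 : ‖h • b i‖ ^ 2 ≤ ε := by
    rw [CStarModule.norm_sq_eq C(K, ℂ), CStarModule.inner_op_smul_right,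
      CStarModule.inner_op_smul_left, ← hg, ContinuousMap.norm_le _ hε0.le]
    intro q
    rw [ContinuousMap.mul_apply, ContinuousMap.mul_apply, ContinuousMap.star_apply, norm_mul,
      norm_mul, norm_star, hq]
    -- The bump function vanishes where `‖g q‖ ≥ ε` and is at most one elsewhere.
    rcases le_or_gt ε ‖g q‖ with hc | hc
    · have : 1 - ‖g q‖ / ε ≤ 0 := by rw [sub_nonpos, le_div_iff₀ hε0, one_mul]; exact hc
      rw [max_eq_left this, zero_mul]
      exact hε0.le
    · have h2 : max 0 (1 - ‖g q‖ / ε) ≤ 1 :=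
        max_le zero_le_one (sub_le_self _ (by positivity))
      have h3 : 0 ≤ max 0 (1 - ‖g q‖ / ε) := le_max_left _ _
      calc _ ≤ 1 * (ε * 1) := by gcongr
        _ = ε := by ring
  have h2 : 1 ≤ C * ‖h • b i‖ := by
    refine le_trans ?_ (hC _ i)
    have : b.repr (h • b i) i = h := by simp
    rw [this, ← hp]
    exact h.norm_coe_le_norm p
  have h3 : (1 : ℝ) ≤ C ^ 2 * ε := by
    calc (1 : ℝ) ≤ (C * ‖h • b i‖) ^ 2 := one_le_pow₀ h2
      _ = C ^ 2 * ‖h • b i‖ ^ 2 := by ring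
      _ ≤ _ := by gcongr
  rw [hε, mul_one_div, le_div_iff₀ (by positivity)] at h3
  linarith

/-- A basis element of a Hilbert module can be scaled to norm one. -/
theorem exists_unit_inner_smul_self [CompleteSpace H] {n : ℕ}
    (b : Module.Basis (Fin n) C(K, ℂ) H) (i : Fin n) :
    ∃ s : C(K, ℂ)ˣ, inner C(K, ℂ) ((s : C(K, ℂ)) • b i) ((s : C(K, ℂ)) • b i) = 1 := by
  set g : C(K, ℂ) := inner C(K, ℂ) (b i) (b i) with hg
  have hpos : ∀ q, 0 ≤ g q := (CStarModule.inner_self_nonneg : 0 ≤ g)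
  have hre : ∀ q, 0 < (g q).re := fun q => by
    have h1 := Complex.nonneg_iff.1 (hpos q)
    refine lt_of_le_of_ne h1.1 fun h => inner_basis_self_apply_ne_zero b i q ?_
    exact Complex.ext h.symm h1.2.symm
  have hsq : ∀ q, √(g q).re ≠ 0 := fun q => (Real.sqrt_pos.2 (hre q)).ne'
  -- The scaling factor is `g ^ (-1/2)`, with inverse `g ^ (1/2)`; both are continuous because `g`
  -- is strictly positive.
  refine ⟨⟨⟨fun q => (((√(g q).re)⁻¹ : ℝ) : ℂ), ?_⟩, ⟨fun q => ((√(g q).re : ℝ) : ℂ), by fun_prop⟩,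
    ?_, ?_⟩, ?_⟩
  · exact Complex.continuous_ofReal.comp (Continuous.inv₀ (by fun_prop) hsq)
  · ext q
    change (((√(g q).re)⁻¹ : ℝ) : ℂ) * ((√(g q).re : ℝ) : ℂ) = 1
    rw [← Complex.ofReal_mul, inv_mul_cancel₀ (hsq q), Complex.ofReal_one]
  · ext q
    change ((√(g q).re : ℝ) : ℂ) * (((√(g q).re)⁻¹ : ℝ) : ℂ) = 1
    rw [← Complex.ofReal_mul, mul_inv_cancel₀ (hsq q), Complex.ofReal_one]
  · refine (CStarModule.inner_op_smul_right.trans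
      (congrArg _ CStarModule.inner_op_smul_left)).trans ?_
    ext q
    change (((√(g q).re)⁻¹ : ℝ) : ℂ) * (g q * star (((√(g q).re)⁻¹ : ℝ) : ℂ)) = 1
    have h2 : g q = (((√(g q).re) * (√(g q).re) : ℝ) : ℂ) := by
      rw [Real.mul_self_sqrt (hre q).le]
      exact Complex.ext rfl (Complex.nonneg_iff.1 (hpos q)).2.symm
    rw [Complex.star_def, Complex.conj_ofReal]
    nth_rw 2 [h2]
    rw [← Complex.ofReal_mul, ← Complex.ofReal_mul, ← Complex.ofReal_one]
    congr 1
    have := hsq q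
    field_simp

/-- The Gram–Schmidt process: a free Hilbert module over `C(K)` has an orthonormal basis. -/
theorem exists_orthonormal_basis [CompleteSpace H] {n : ℕ}
    (b₀ : Module.Basis (Fin n) C(K, ℂ) H) :
    ∃ b : Module.Basis (Fin n) C(K, ℂ) H,
      ∀ i j, inner C(K, ℂ) (b i) (b j) = if i = j then 1 else 0 := by
  -- The index `j` is unrestricted: each round clears the new unit vector out of all other basis
  -- vectors, so later vectors are already orthogonal to the finished ones.
  suffices h : ∀ r ≤ n, ∃ b : Module.Basis (Fin n) C(K, ℂ) H, ∀ i j : Fin n, (i : ℕ) < r →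
      inner C(K, ℂ) (b i) (b j) = if i = j then 1 else 0 by
    obtain ⟨b, hb⟩ := h n le_rfl
    exact ⟨b, fun i j => hb i j i.2⟩
  intro r
  induction r with
  | zero => exact fun _ => ⟨b₀, fun i j h => absurd h (Nat.not_lt_zero _)⟩
  | succ r ih =>
    intro hr
    obtain ⟨b, hb⟩ := ih (Nat.le_of_succ_le hr)
    let i₀ : Fin n := ⟨r, hr⟩
    obtain ⟨s, hs⟩ := exists_unit_inner_smul_self b i₀
    let b₁ := b.unitsSMul (Function.update 1 i₀ s)
    have hb₁x : b₁ i₀ = (s : C(K, ℂ)) • b i₀ := by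
      simp [b₁, Module.Basis.unitsSMul_apply, Units.smul_def]
    have hb₁ : ∀ j, j ≠ i₀ → b₁ j = b j := fun j hj => by
      simp [b₁, Module.Basis.unitsSMul_apply, Function.update_of_ne hj]
    set x := b₁ i₀ with hx
    have hxx : inner C(K, ℂ) x x = 1 := by rw [hb₁x]; exact hs
    have hlt : ∀ i : Fin n, (i : ℕ) < r → i ≠ i₀ := fun i hi h => by
      rw [h] at hi; exact lt_irrefl r hi
    have hix : ∀ i : Fin n, (i : ℕ) < r → inner C(K, ℂ) (b i) x = 0 := fun i hi => by
      rw [hb₁x, CStarModule.inner_op_smul_right, hb i i₀ hi, if_neg (hlt i hi), mul_zero]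
    -- Since `f x = 0`, the transvection `y ↦ y + f y • x` is invertible and so carries a basis to a
    -- basis. It fixes `x` and subtracts from every other basis vector its projection onto `x`.
    let f : Module.Dual C(K, ℂ) H := b₁.coord i₀ -
      { toFun := fun y => inner C(K, ℂ) x y
        map_add' := fun _ _ => CStarModule.inner_add_right
        map_smul' := fun _ _ => CStarModule.inner_op_smul_right }
    have hf : ∀ y, f y = b₁.repr y i₀ - inner C(K, ℂ) x y := fun y => rfl
    have hfx : f x = 0 := by rw [hf, hxx, hx]; simp
    let b₂ := b₁.map (LinearEquiv.transvection hfx)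
    have hb₂ : ∀ j, b₂ j = b₁ j + f (b₁ j) • x := fun j => by
      simp [b₂, LinearMap.transvection.apply]
    have hb₂x : b₂ i₀ = x := by rw [hb₂, ← hx, hfx, zero_smul, add_zero]
    have hb₂' : ∀ j, j ≠ i₀ → b₂ j = b j - inner C(K, ℂ) x (b j) • x := fun j hj => by
      rw [hb₂, hf, hb₁ j hj, ← hb₁ j hj, b₁.repr_self, Finsupp.single_eq_of_ne hj.symm, zero_sub,
        neg_smul, sub_eq_add_neg]
    refine ⟨b₂, fun i j hi => ?_⟩
    rcases Nat.lt_succ_iff_lt_or_eq.1 hi with hi | hi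
    · have hi' : b₂ i = b i := by
        rw [hb₂' i (hlt i hi), ← CStarModule.star_inner, hix i hi, star_zero, zero_smul, sub_zero]
      rw [hi']
      by_cases hj : j = i₀
      · rw [hj, hb₂x, hix i hi, if_neg (hlt i hi)]
      · rw [hb₂' j hj, CStarModule.inner_sub_right, CStarModule.inner_op_smul_right, hix i hi,
          mul_zero, sub_zero, hb i j hi]
    · have hii : i = i₀ := Fin.ext hi
      subst hii
      rw [hb₂x]
      by_cases hj : j = i₀
      · rw [hj, hb₂x, hxx, if_pos rfl]
      · rw [hb₂' j hj, CStarModule.inner_sub_right, CStarModule.inner_op_smul_right, hxx,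
          mul_one, sub_self, if_neg (Ne.symm hj)]

theorem repr_eq_inner {n : ℕ} {b : Module.Basis (Fin n) C(K, ℂ) H}
    (hb : ∀ i j, inner C(K, ℂ) (b i) (b j) = if i = j then 1 else 0) (x : H) (i : Fin n) :
    b.repr x i = inner C(K, ℂ) (b i) x := by
  conv_rhs => rw [← b.sum_repr x]
  simp only [CStarModule.inner_sum_right, CStarModule.inner_op_smul_right, hb, mul_ite, mul_one,
    mul_zero, Finset.sum_ite_eq, Finset.mem_univ, if_true]

theorem sum_inner_smul {n : ℕ} {b : Module.Basis (Fin n) C(K, ℂ) H}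
    (hb : ∀ i j, inner C(K, ℂ) (b i) (b j) = if i = j then 1 else 0) (x : H) :
    ∑ i, inner C(K, ℂ) (b i) x • b i = x := by
  simp_rw [← repr_eq_inner hb]
  exact b.sum_repr x

theorem inner_sum_smul {n : ℕ} {e : Fin n → H}
    (he : ∀ i j, inner C(K, ℂ) (e i) (e j) = if i = j then 1 else 0) (f g : Fin n → C(K, ℂ)) :
    inner C(K, ℂ) (∑ i, f i • e i) (∑ i, g i • e i) = ∑ i, g i * star (f i) := by
  simp [he]

theorem inner_sum_smul_right {n : ℕ} {e : Fin n → H}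
    (he : ∀ i j, inner C(K, ℂ) (e i) (e j) = if i = j then 1 else 0) (f : Fin n → C(K, ℂ))
    (i : Fin n) : inner C(K, ℂ) (e i) (∑ j, f j • e j) = f i := by
  simp [he]

/-- A vector for which Parseval's identity holds has an orthonormal expansion. -/
theorem sum_inner_smul_of_parseval {n : ℕ} {e : Fin n → H}
    (he : ∀ i j, inner C(K, ℂ) (e i) (e j) = if i = j then 1 else 0) {x : H}
    (hx : inner C(K, ℂ) x x = ∑ i, inner C(K, ℂ) (e i) x * star (inner C(K, ℂ) (e i) x)) :
    ∑ i, inner C(K, ℂ) (e i) x • e i = x := by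
  have h1 : inner C(K, ℂ) (∑ i, inner C(K, ℂ) (e i) x • e i) x = inner C(K, ℂ) x x := by
    rw [CStarModule.inner_sum_left, hx]
    exact Finset.sum_congr rfl fun i _ => CStarModule.inner_op_smul_left
  have h2 : inner C(K, ℂ) x (∑ i, inner C(K, ℂ) (e i) x • e i) = inner C(K, ℂ) x x := by
    rw [← CStarModule.star_inner, h1, CStarModule.star_inner]
  -- Pythagoras: all four terms in the inner square of the remainder equal the inner square of `x`
  -- up to sign, and they cancel.
  rw [← sub_eq_zero, ← CStarModule.inner_self (A := C(K, ℂ)), CStarModule.inner_sub_left,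
    CStarModule.inner_sub_right, CStarModule.inner_sub_right, h1, h2, inner_sum_smul he, hx]
  simp

/-- An orthonormal family in which every vector can be expanded is a basis. -/
theorem nonempty_basis_of_orthonormal {n : ℕ} {e : Fin n → H}
    (he : ∀ i j, inner C(K, ℂ) (e i) (e j) = if i = j then 1 else 0)
    (hx : ∀ x : H, ∑ i, inner C(K, ℂ) (e i) x • e i = x) :
    Nonempty (Module.Basis (Fin n) C(K, ℂ) H) :=
  ⟨Module.Basis.ofEquivFun
    { toFun := fun x i => inner C(K, ℂ) (e i) x
      map_add' := fun x y => funext fun i => CStarModule.inner_add_right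
      map_smul' := fun a x => funext fun i => CStarModule.inner_op_smul_right
      invFun := fun a => ∑ i, a i • e i
      left_inv := hx
      right_inv := fun a => funext fun i => by simp [he] }⟩

end Orthonormal

/-! ### Completeness of the multiplier module -/

section Complete

variable {A : Type u} [NonUnitalCStarAlgebra A] [PartialOrder A] [StarOrderedRing A]
variable {V : Type v} [NormedAddCommGroup V] [NormedSpace ℂ V] [SMul A V] [CStarModule A V]

/-- Here `s` is the value of the adjoint of `T` at `x`. Testing against `a = s` and using the
C*-identity bounds `‖s‖ ^ 2`, and one factor `‖s‖` cancels. -/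
theorem norm_le_of_forall_inner_eq {T : A →L[ℂ] V} {x : V} {s : A}
    (h : ∀ a, inner A (T a) x = inner A a s) : ‖s‖ ≤ ‖T‖ * ‖x‖ := by
  have h1 : ‖s‖ * ‖s‖ ≤ (‖T‖ * ‖x‖) * ‖s‖ := by
    calc ‖s‖ * ‖s‖ = ‖inner A (T s) x‖ := by
          rw [h, WithCStarModule.inner_def, CStarRing.norm_self_mul_star]
      _ ≤ ‖T s‖ * ‖x‖ := CStarModule.norm_inner_le V
      _ ≤ (‖T‖ * ‖s‖) * ‖x‖ := by gcongr; exact T.le_opNorm s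
      _ = _ := by ring
  rcases (norm_nonneg s).eq_or_lt with h0 | h0
  · rw [← h0]; positivity
  · exact le_of_mul_le_mul_right h1 h0

/-- For a norm convergent sequence of adjointable maps, the bound on adjoints makes the adjoints
pointwise Cauchy; by continuity of the inner product, their pointwise limit is an adjoint of the
limit. This yields completeness of `M(V)` and `Q(V)`. -/
theorem isClosed_adjointableMaps : IsClosed (adjointableMaps A V : Set (A →L[ℂ] V)) := by
  refine IsSeqClosed.isClosed fun T T₀ hT hlim => ?_
  choose S hS using hT
  have hcs : ∀ x, CauchySeq fun n => S n x := fun x => by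
    have hc : CauchySeq T := hlim.cauchySeq
    rw [Metric.cauchySeq_iff'] at hc ⊢
    intro ε hε
    -- The summand `1` covers the case `x = 0`.
    obtain ⟨N, hN⟩ := hc (ε / (‖x‖ + 1)) (by positivity)
    refine ⟨N, fun n hn => ?_⟩
    have h1 : ‖S n x - S N x‖ ≤ ‖T n - T N‖ * ‖x‖ := norm_le_of_forall_inner_eq fun a => by
      rw [_root_.sub_apply, CStarModule.inner_sub_left, hS, hS, CStarModule.inner_sub_right]
    have h2 := hN n hn
    rw [dist_eq_norm, lt_div_iff₀ (by positivity)] at h2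
    rw [dist_eq_norm]
    calc _ ≤ ‖T n - T N‖ * ‖x‖ := h1
      _ ≤ ‖T n - T N‖ * (‖x‖ + 1) := by gcongr; linarith
      _ < ε := h2
  choose S₀ hS₀ using fun x => cauchySeq_tendsto_of_complete (hcs x)
  refine ⟨S₀, fun a x => ?_⟩
  have h1 : Filter.Tendsto (fun n => inner A (T n a) x) Filter.atTop (𝓝 (inner A (T₀ a) x)) := by
    have h2 : Filter.Tendsto (fun n => T n a) Filter.atTop (𝓝 (T₀ a)) :=
      ((ContinuousLinearMap.apply ℂ V a).continuous.tendsto T₀).comp hlim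
    exact (CStarModule.continuous_inner.tendsto (T₀ a, x)).comp (h2.prodMk_nhds tendsto_const_nhds)
  have h2 : Filter.Tendsto (fun n => inner A (T n a) x) Filter.atTop (𝓝 (inner A a (S₀ x))) := by
    simp_rw [hS]
    exact (CStarModule.continuous_inner.tendsto (a, S₀ x)).comp
      (tendsto_const_nhds.prodMk_nhds (hS₀ x))
  exact tendsto_nhds_unique h1 h2

instance instCompleteSpaceMultiplierModule [CompleteSpace V] :
    CompleteSpace (MultiplierModule A V) :=
  isClosed_adjointableMaps.completeSpace_coe

instance instCompleteSpaceQuotientModule [CompleteSpace V] :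
    CompleteSpace (QuotientModule A V) :=
  inferInstanceAs (CompleteSpace (MultiplierModule A V ⧸ LinearMap.range (multiplierIncl A V)))

theorem norm_toQuotient_le (T : MultiplierModule A V) : ‖toQuotient A V T‖ ≤ ‖T‖ :=
  Submodule.Quotient.norm_mk_le (LinearMap.range (multiplierIncl A V)) T

theorem exists_toQuotient_eq_norm_lt (q : QuotientModule A V) {ε : ℝ} (hε : 0 < ε) :
    ∃ T : MultiplierModule A V, toQuotient A V T = q ∧ ‖T‖ < ‖q‖ + ε :=
  Submodule.Quotient.norm_mk_lt (S := LinearMap.range (multiplierIncl A V)) q hε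

theorem continuous_toQuotient : Continuous (toQuotient A V) :=
  AddMonoidHomClass.continuous_of_bound (toQuotient A V) 1 fun T => by
    rw [one_mul]; exact norm_toQuotient_le T

end Complete

/-! ### The Hilbert module structures of `M(V)` and `Q(V)` -/

section HilbertStructures

variable {Y : Type u} [TopologicalSpace Y] [T35Space Y] [LocallyCompactSpace Y]
variable {V : Type v} [NormedAddCommGroup V] [NormedSpace ℂ V] [SMul C₀(Y, ℂ) V]
  [CStarModule C₀(Y, ℂ) V] [CompleteSpace V]

/-- The operator norm on `M(V)` is thus its Hilbert module norm. One inequality follows from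
evaluating the inner square of `T a` pointwise; for the other, a local unit of norm at most one
recovers the value of `T* T` at each point of `Y`, which is dense in `βY`. -/
theorem norm_sq_eq_norm_multiplierInner (T : MultiplierModule C₀(Y, ℂ) V) :
    ‖T‖ ^ 2 = ‖multiplierInner T T‖ := by
  refine le_antisymm ?_ ?_
  · rw [← Real.sqrt_le_sqrt_iff (norm_nonneg _), Real.sqrt_sq (norm_nonneg _)]
    refine T.1.opNorm_le_bound (Real.sqrt_nonneg _) fun a => ?_
    refine norm_le_of_inner_apply (Y := Y) (by positivity) fun y => ?_
    rw [multiplierInner_spec, norm_mul, norm_mul, norm_star, mul_pow,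
      Real.sq_sqrt (norm_nonneg _)]
    have h1 := norm_c0_apply_le a y
    have h2 := (multiplierInner T T).norm_coe_le_norm (stoneCechUnit y)
    calc _ ≤ ‖a‖ * ‖multiplierInner T T‖ * ‖a‖ := by gcongr
      _ = _ := by ring
  · rw [ContinuousMap.norm_le _ (by positivity)]
    intro p
    refine denseRange_stoneCechUnit.induction_on p (isClosed_le (by fun_prop) continuous_const)
      fun y => ?_
    obtain ⟨a, ha, ha1⟩ := exists_local_unit y
    have h1 := multiplierInner_spec T T a a y
    rw [ha.self_of_nhds, star_one, one_mul, mul_one] at h1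
    rw [← h1]
    have h2 : ‖T a‖ ≤ ‖T‖ := (T.1.le_opNorm a).trans (mul_le_of_le_one_right (norm_nonneg _) ha1)
    calc _ ≤ ‖inner C₀(Y, ℂ) (T a) (T a)‖ := norm_c0_apply_le _ y
      _ = ‖T a‖ ^ 2 := (CStarModule.norm_sq_eq _).symm
      _ ≤ _ := by gcongr

theorem multiplierInner_self_nonneg (T : MultiplierModule C₀(Y, ℂ) V) :
    0 ≤ multiplierInner T T := fun p => by
  change 0 ≤ multiplierInner T T p
  refine denseRange_stoneCechUnit.induction_on p (isClosed_le continuous_const (by fun_prop))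
    fun y => ?_
  obtain ⟨a, ha, -⟩ := exists_local_unit y
  have h1 := multiplierInner_spec T T a a y
  rw [ha.self_of_nhds, star_one, one_mul, mul_one] at h1
  rw [← h1]
  exact (CStarModule.inner_self_nonneg : 0 ≤ inner C₀(Y, ℂ) (T a) (T a)) y

variable (Y V) in
/-- `M(V)` as a module over `C(βY)`. -/
instance instModuleMultiplierModule : Module C(StoneCech Y, ℂ) (MultiplierModule C₀(Y, ℂ) V) :=
  Module.compHom _ (multiplierAction Y V)

theorem multiplier_smul_eq (G : C(StoneCech Y, ℂ)) (T : MultiplierModule C₀(Y, ℂ) V) :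
    G • T = actionMap G T := rfl

/-- `M(V)` as a Hilbert module over `C(βY)`. -/
instance instCStarModuleMultiplierModule :
    CStarModule C(StoneCech Y, ℂ) (MultiplierModule C₀(Y, ℂ) V) where
  inner T S := multiplierInner T S
  inner_add_right := multiplierInner_add_right _ _ _
  inner_self_nonneg := multiplierInner_self_nonneg _
  inner_self {T} := by
    rw [← norm_eq_zero, ← norm_sq_eq_norm_multiplierInner, sq_eq_zero_iff, norm_eq_zero]
  inner_op_smul_right {G T S} := multiplierInner_eq fun a b y => by
    rw [multiplier_smul_eq, actionMap_apply, multiplierInner_spec, mulC0_apply,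
      ContinuousMap.mul_apply]
    ring
  inner_smul_right_complex {c T S} := multiplierInner_eq fun a b y => by
    rw [multiplier_smul_apply, CStarModule.inner_smul_right_complex,
      ZeroAtInftyContinuousMap.smul_apply, multiplierInner_spec, ContinuousMap.smul_apply,
      smul_eq_mul, smul_eq_mul]
    ring
  star_inner := star_multiplierInner
  norm_eq_sqrt_norm_inner_self T := by
    rw [← norm_sq_eq_norm_multiplierInner, Real.sqrt_sq (norm_nonneg _)]

theorem multiplier_inner_def (T S : MultiplierModule C₀(Y, ℂ) V) :
    inner C(StoneCech Y, ℂ) T S = multiplierInner T S := rfl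

theorem coronaRestrict_smul_toQuotient' (G : C(StoneCech Y, ℂ))
    (T : MultiplierModule C₀(Y, ℂ) V) :
    toQuotient _ _ (G • T) = coronaRestrict G • toQuotient C₀(Y, ℂ) V T :=
  (coronaRestrict_smul_toQuotient G T).symm

/-- Multiplying `T` by a function on `βY` equal to one on the corona does not change its class, and
such a cutoff can bring the norm of the representative down to the supremum over the corona, up to
`ε`. Conversely, every representative has the same inner square on the corona, so its norm cannot be
smaller. -/
theorem norm_sq_toQuotient (T : MultiplierModule C₀(Y, ℂ) V) :
    ‖toQuotient C₀(Y, ℂ) V T‖ ^ 2 = ‖coronaRestrict (multiplierInner T T)‖ := by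
  set G := multiplierInner T T with hG
  refine le_antisymm ?_ ?_
  · refine le_of_forall_pos_le_add fun ε hε => ?_
    -- Adding `ε` makes `c` positive, so that one may divide by `max ‖G q‖ c`. On the corona this
    -- maximum is `c`, hence the cutoff `Φ` is one there, while `‖Φ‖ ^ 2 * ‖G‖ ≤ c` on all of `βY`.
    set c := ‖coronaRestrict G‖ + ε with hc
    have hc0 : 0 < c := by positivity
    have hm : ∀ q, 0 < max ‖G q‖ c := fun q => lt_max_of_lt_right hc0
    let Φ : C(StoneCech Y, ℂ) := ⟨fun q => ((c / max ‖G q‖ c : ℝ) : ℂ),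
      Complex.continuous_ofReal.comp
        (continuous_const.div (by fun_prop) fun q => (hm q).ne')⟩
    have hΦn : ∀ q, ‖Φ q‖ = c / max ‖G q‖ c := fun q => by
      change ‖((c / max ‖G q‖ c : ℝ) : ℂ)‖ = _
      rw [Complex.norm_real, Real.norm_eq_abs, abs_of_nonneg (by positivity)]
    have hΦ : coronaRestrict Φ = 1 := by
      ext p
      have h1 : ‖G p.1‖ ≤ c :=
        ((coronaRestrict G).norm_coe_le_norm p).trans (le_add_of_nonneg_right hε.le)
      change ((c / max ‖G p.1‖ c : ℝ) : ℂ) = 1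
      rw [max_eq_right h1, div_self hc0.ne', Complex.ofReal_one]
    have h1 : toQuotient C₀(Y, ℂ) V (Φ • T) = toQuotient _ _ T := by
      rw [coronaRestrict_smul_toQuotient', hΦ, one_smul]
    have h2 : ‖Φ • T‖ ^ 2 ≤ c := by
      rw [CStarModule.norm_sq_eq C(StoneCech Y, ℂ), CStarModule.inner_op_smul_right,
        CStarModule.inner_op_smul_left, multiplier_inner_def, ← hG, ContinuousMap.norm_le _ hc0.le]
      intro q
      rw [ContinuousMap.mul_apply, ContinuousMap.mul_apply, ContinuousMap.star_apply, norm_mul,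
        norm_mul, norm_star, hΦn]
      have h3 : c / max ‖G q‖ c ≤ 1 := (div_le_one (hm q)).2 (le_max_right _ _)
      have h4 : ‖G q‖ * (c / max ‖G q‖ c) ≤ c := by
        rw [mul_div_assoc', div_le_iff₀ (hm q), mul_comm]
        gcongr
        exact le_max_left _ _
      have h5 : 0 ≤ c / max ‖G q‖ c := by positivity
      calc _ ≤ 1 * c := by gcongr
        _ = c := one_mul c
    rw [← h1]
    exact (pow_le_pow_left₀ (norm_nonneg _) (norm_toQuotient_le _) 2).trans h2
  · have key : √‖coronaRestrict G‖ ≤ ‖toQuotient C₀(Y, ℂ) V T‖ := by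
      refine le_of_forall_pos_le_add fun ε hε => ?_
      obtain ⟨S, hS, hSn⟩ := exists_toQuotient_eq_norm_lt (toQuotient C₀(Y, ℂ) V T) hε
      refine le_trans ?_ hSn.le
      rw [hG, coronaRestrict_inner_congr hS.symm hS.symm, Real.sqrt_le_left (norm_nonneg _),
        norm_sq_eq_norm_multiplierInner, ContinuousMap.norm_le _ (norm_nonneg _)]
      exact fun p => (multiplierInner S S).norm_coe_le_norm p.1
    rwa [Real.sqrt_le_left (norm_nonneg _)] at key

/-- If `T* T` vanishes on the corona, it belongs to `C₀(Y)`, and then `exists_multiplierIncl_eq`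
places `T` in the image of `V`. Consequently the quotient seminorm is a norm. -/
theorem quotient_inner_self_eq_zero {q : QuotientModule C₀(Y, ℂ) V} :
    inner C(Corona Y, ℂ) q q = 0 ↔ q = 0 := by
  obtain ⟨T, rfl⟩ := toQuotient_surjective q
  rw [inner_toQuotient]
  refine ⟨fun h => ?_, fun h => ?_⟩
  · obtain ⟨f, hf⟩ := exists_c0_of_coronaRestrict_eq_zero h
    rw [toQuotient_eq_zero_iff]
    refine exists_multiplierIncl_eq T f fun a y => ?_
    rw [multiplierInner_spec, hf]; ring
  · rw [← norm_eq_zero, ← norm_sq_toQuotient, h, norm_zero]; norm_num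

variable (Y V) in
/-- The quotient norm of `Q(V)` is a norm. -/
@[reducible]
def quotientNormedAddCommGroup : NormedAddCommGroup (QuotientModule C₀(Y, ℂ) V) :=
  NormedAddCommGroup.ofSeparation fun q h => by
    obtain ⟨T, rfl⟩ := toQuotient_surjective q
    rw [← quotient_inner_self_eq_zero, inner_toQuotient, ← norm_eq_zero, ← norm_sq_toQuotient, h]
    norm_num

/-- `Q(V)` as a Hilbert module over `C(βY ∖ Y)`. -/
instance instCStarModuleQuotientModule :
    CStarModule C(Corona Y, ℂ) (QuotientModule C₀(Y, ℂ) V) where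
  inner_add_right {p q r} := by
    obtain ⟨T, rfl⟩ := toQuotient_surjective p
    obtain ⟨S, rfl⟩ := toQuotient_surjective q
    obtain ⟨R, rfl⟩ := toQuotient_surjective r
    rw [← map_add, inner_toQuotient, inner_toQuotient, inner_toQuotient,
      multiplierInner_add_right, map_add]
  inner_self_nonneg {p} := by
    obtain ⟨T, rfl⟩ := toQuotient_surjective p
    exact fun q => multiplierInner_self_nonneg T q.1
  inner_self := quotient_inner_self_eq_zero
  inner_op_smul_right {f p q} := by
    obtain ⟨G, rfl⟩ := coronaRestrict_surjective f
    obtain ⟨T, rfl⟩ := toQuotient_surjective p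
    obtain ⟨S, rfl⟩ := toQuotient_surjective q
    rw [← coronaRestrict_smul_toQuotient', inner_toQuotient, inner_toQuotient,
      ← multiplier_inner_def, CStarModule.inner_op_smul_right, map_mul]
    rfl
  inner_smul_right_complex {c p q} := by
    obtain ⟨T, rfl⟩ := toQuotient_surjective p
    obtain ⟨S, rfl⟩ := toQuotient_surjective q
    rw [← map_smul, inner_toQuotient, inner_toQuotient, ← multiplier_inner_def,
      CStarModule.inner_smul_right_complex]
    rfl
  star_inner p q := by
    obtain ⟨T, rfl⟩ := toQuotient_surjective p
    obtain ⟨S, rfl⟩ := toQuotient_surjective q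
    rw [inner_toQuotient, inner_toQuotient, ← coronaRestrict_star, star_multiplierInner]
  norm_eq_sqrt_norm_inner_self p := by
    obtain ⟨T, rfl⟩ := toQuotient_surjective p
    rw [inner_toQuotient, ← norm_sq_toQuotient, Real.sqrt_sq (norm_nonneg _)]

end HilbertStructures

/-! ### Orthonormal bases of `Q(V)` -/

section QuotientBases

variable {Y : Type u} [TopologicalSpace Y] [T35Space Y] [LocallyCompactSpace Y]
variable {V : Type v} [NormedAddCommGroup V] [NormedSpace ℂ V] [SMul C₀(Y, ℂ) V]
  [CStarModule C₀(Y, ℂ) V] [CompleteSpace V] {n : ℕ}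

/-- `Q(V)` is given with a seminorm. Here and in the next lemmas, the fact that it is a norm makes
the results on Hilbert modules over `C(K)` applicable. -/
theorem quotient_exists_orthonormal_basis
    (b₀ : Module.Basis (Fin n) C(Corona Y, ℂ) (QuotientModule C₀(Y, ℂ) V)) :
    ∃ b : Module.Basis (Fin n) C(Corona Y, ℂ) (QuotientModule C₀(Y, ℂ) V),
      ∀ i j, inner C(Corona Y, ℂ) (b i) (b j) = if i = j then 1 else 0 :=
  letI := quotientNormedAddCommGroup Y V
  exists_orthonormal_basis b₀

theorem quotient_sum_inner_smul
    {b : Module.Basis (Fin n) C(Corona Y, ℂ) (QuotientModule C₀(Y, ℂ) V)}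
    (hb : ∀ i j, inner C(Corona Y, ℂ) (b i) (b j) = if i = j then 1 else 0)
    (q : QuotientModule C₀(Y, ℂ) V) : ∑ i, inner C(Corona Y, ℂ) (b i) q • b i = q :=
  letI := quotientNormedAddCommGroup Y V
  sum_inner_smul hb q

theorem quotient_nonempty_basis_of_orthonormal {e : Fin n → QuotientModule C₀(Y, ℂ) V}
    (he : ∀ i j, inner C(Corona Y, ℂ) (e i) (e j) = if i = j then 1 else 0)
    (hx : ∀ q, ∑ i, inner C(Corona Y, ℂ) (e i) q • e i = q) :
    Nonempty (Module.Basis (Fin n) C(Corona Y, ℂ) (QuotientModule C₀(Y, ℂ) V)) :=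
  letI := quotientNormedAddCommGroup Y V
  nonempty_basis_of_orthonormal he hx

theorem quotient_inner_sum_smul {e : Fin n → QuotientModule C₀(Y, ℂ) V}
    (he : ∀ i j, inner C(Corona Y, ℂ) (e i) (e j) = if i = j then 1 else 0)
    (f g : Fin n → C(Corona Y, ℂ)) :
    inner C(Corona Y, ℂ) (∑ i, f i • e i) (∑ i, g i • e i) = ∑ i, g i * star (f i) :=
  letI := quotientNormedAddCommGroup Y V
  inner_sum_smul he f g

theorem quotient_inner_sum_smul_right {e : Fin n → QuotientModule C₀(Y, ℂ) V}
    (he : ∀ i j, inner C(Corona Y, ℂ) (e i) (e j) = if i = j then 1 else 0)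
    (f : Fin n → C(Corona Y, ℂ)) (i : Fin n) :
    inner C(Corona Y, ℂ) (e i) (∑ j, f j • e j) = f i :=
  letI := quotientNormedAddCommGroup Y V
  inner_sum_smul_right he f i

theorem quotient_sum_inner_smul_of_parseval {e : Fin n → QuotientModule C₀(Y, ℂ) V}
    (he : ∀ i j, inner C(Corona Y, ℂ) (e i) (e j) = if i = j then 1 else 0)
    {q : QuotientModule C₀(Y, ℂ) V} (hq : inner C(Corona Y, ℂ) q q =
      ∑ i, inner C(Corona Y, ℂ) (e i) q * star (inner C(Corona Y, ℂ) (e i) q)) :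
    ∑ i, inner C(Corona Y, ℂ) (e i) q • e i = q :=
  letI := quotientNormedAddCommGroup Y V
  sum_inner_smul_of_parseval he hq

theorem quotient_continuous_smul_right (q : QuotientModule C₀(Y, ℂ) V) :
    Continuous fun a : C(Corona Y, ℂ) => a • q :=
  letI := quotientNormedAddCommGroup Y V
  continuous_smul_right q

theorem quotient_continuous_inner_right (q : QuotientModule C₀(Y, ℂ) V) :
    Continuous fun r => inner C(Corona Y, ℂ) q r :=
  letI := quotientNormedAddCommGroup Y V
  CStarModule.continuous_inner.comp (Continuous.prodMk_right q)

end QuotientBases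

/-! ### Busby morphisms and maps to the Stiefel manifold -/

section Frames

variable {X : Type u} [TopologicalSpace X] [CompactSpace X] [T2Space X]
variable {U : TopologicalSpace.Opens X}
variable {V : Type v} [NormedAddCommGroup V] [NormedSpace ℂ V] [SMul C₀(U, ℂ) V]
  [CStarModule C₀(U, ℂ) V] [CompleteSpace V]
variable {Z : Type w} [NormedAddCommGroup Z] [NormedSpace ℂ Z] [Module C(Boundary U, ℂ) Z]
  [CStarModule C(Boundary U, ℂ) Z]
variable {k m : ℕ} {e : Module.Basis (Fin k) C(Boundary U, ℂ) Z}
  {b : Module.Basis (Fin m) C(Corona U, ℂ) (QuotientModule C₀(U, ℂ) V)}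

/-- The homomorphism `δ : C(∂U) → C(βU ∖ U)`. -/
def coronaPullback : C(Boundary U, ℂ) →⋆ₐ[ℂ] C(Corona U, ℂ) :=
  ContinuousMap.compStarAlgHom' ℂ ℂ (coronaMap U)

theorem coronaPullback_apply (f : C(Boundary U, ℂ)) :
    coronaPullback f = f.comp (coronaMap U) := rfl

theorem BusbyMorphism.inner_eq (Δ : BusbyMorphism U V Z) (z z' : Z) :
    inner C(Corona U, ℂ) (Δ.1 z) (Δ.1 z') = coronaPullback (inner C(Boundary U, ℂ) z z') :=
  Δ.2 z z'

/-- A Busby morphism is determined by its values on an orthonormal basis. -/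
theorem BusbyMorphism.apply_eq_sum
    (he : ∀ i j, inner C(Boundary U, ℂ) (e i) (e j) = if i = j then 1 else 0)
    (Δ : BusbyMorphism U V Z) (z : Z) :
    Δ.1 z = ∑ j, coronaPullback (inner C(Boundary U, ℂ) (e j) z) • Δ.1 (e j) := by
  set a : Fin k → C(Corona U, ℂ) := fun j => coronaPullback (inner C(Boundary U, ℂ) (e j) z)
    with ha
  have hoe : ∀ i j, inner C(Corona U, ℂ) (Δ.1 (e i)) (Δ.1 (e j)) = if i = j then 1 else 0 :=
    fun i j => by rw [Δ.inner_eq, he]; split_ifs <;> simp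
  have hez : ∀ j, inner C(Corona U, ℂ) (Δ.1 (e j)) (Δ.1 z) = a j := fun j => Δ.inner_eq _ _
  -- The vectors `Δ.1 (e j)` need not span `Q(V)`. The expansion of `Δ.1 z` in them rests on
  -- Parseval's identity for `z`, which `δ` carries over to `Δ.1 z`.
  have hzz : inner C(Corona U, ℂ) (Δ.1 z) (Δ.1 z) = ∑ j, a j * star (a j) := by
    have h1 : inner C(Boundary U, ℂ) z z = ∑ j, inner C(Boundary U, ℂ) (e j) z *
        star (inner C(Boundary U, ℂ) (e j) z) := by
      conv_lhs => rw [← sum_inner_smul he z]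
      exact inner_sum_smul he _ _
    rw [Δ.inner_eq, h1, map_sum]
    simp only [map_mul, map_star, ha]
  have hx := quotient_sum_inner_smul_of_parseval hoe (q := Δ.1 z) (by simp_rw [hez]; exact hzz)
  simp_rw [hez] at hx
  exact hx.symm

/-- The map `βU ∖ U → V_{k,m}` given by the matrix of a Busby morphism with respect to
orthonormal bases. -/
def BusbyMorphism.frameMap
    (he : ∀ i j, inner C(Boundary U, ℂ) (e i) (e j) = if i = j then 1 else 0)
    (hb : ∀ i j, inner C(Corona U, ℂ) (b i) (b j) = if i = j then 1 else 0)
    (Δ : BusbyMorphism U V Z) : C(Corona U, Stiefel k m) where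
  toFun p := ⟨fun j => WithLp.toLp 2 fun i => inner C(Corona U, ℂ) (b i) (Δ.1 (e j)) p, by
    rw [orthonormal_iff_ite]
    intro j l
    -- Expanding both images in the basis `b` turns their inner product into the pointwise inner
    -- product of two columns of the matrix.
    have h1 := quotient_inner_sum_smul hb (fun i => inner C(Corona U, ℂ) (b i) (Δ.1 (e j)))
      (fun i => inner C(Corona U, ℂ) (b i) (Δ.1 (e l)))
    rw [quotient_sum_inner_smul hb, quotient_sum_inner_smul hb, Δ.inner_eq, he] at h1
    have h2 := DFunLike.congr_fun h1 p
    rw [ContinuousMap.sum_apply] at h2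
    rw [PiLp.inner_apply]
    refine Eq.trans ?_ (h2.symm.trans ?_)
    · rfl
    · split_ifs <;> simp⟩
  continuous_toFun := by
    refine Continuous.subtype_mk (continuous_pi fun j => ?_) _
    exact (PiLp.continuous_toLp 2 _).comp (continuous_pi fun i => map_continuous _)

/-- The matrix entries of a map to the Stiefel manifold. -/
def frameEntry {K : Type*} [TopologicalSpace K] (F : C(K, Stiefel k m)) (i : Fin m) (j : Fin k) :
    C(K, ℂ) :=
  ⟨fun p => (F p).1 j i, by
    have h1 : Continuous fun p => (F p).1 j :=
      (continuous_apply j).comp (continuous_subtype_val.comp F.continuous)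
    exact (PiLp.continuous_apply 2 (fun _ : Fin m => ℂ) i).comp h1⟩

/-- The Busby morphism with a given matrix. -/
def BusbyMorphism.ofFrameMap
    (he : ∀ i j, inner C(Boundary U, ℂ) (e i) (e j) = if i = j then 1 else 0)
    (hb : ∀ i j, inner C(Corona U, ℂ) (b i) (b j) = if i = j then 1 else 0)
    (F : C(Corona U, Stiefel k m)) : BusbyMorphism U V Z :=
  ⟨fun z => ∑ j, coronaPullback (inner C(Boundary U, ℂ) (e j) z) • ∑ i, frameEntry F i j • b i,
    fun z z' => by
    -- Frames that are orthonormal at each point have columns that are orthonormal in `Q(V)`.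
    have ho : ∀ j l, inner C(Corona U, ℂ) (∑ i, frameEntry F i j • b i)
        (∑ i, frameEntry F i l • b i) = if j = l then 1 else 0 := fun j l => by
      rw [quotient_inner_sum_smul hb]
      ext p
      have h1 := orthonormal_iff_ite.1 (F p).2 j l
      rw [PiLp.inner_apply] at h1
      rw [ContinuousMap.sum_apply]
      refine Eq.trans ?_ (h1.trans ?_)
      · rfl
      · split_ifs <;> simp
    rw [quotient_inner_sum_smul ho]
    have h1 : inner C(Boundary U, ℂ) z z' = ∑ j, inner C(Boundary U, ℂ) (e j) z' *
        star (inner C(Boundary U, ℂ) (e j) z) := by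
      conv_lhs => rw [← sum_inner_smul he z, ← sum_inner_smul he z']
      exact inner_sum_smul he _ _
    rw [← coronaPullback_apply, h1, map_sum]
    simp only [map_mul, map_star]⟩

theorem BusbyMorphism.ofFrameMap_apply
    (he : ∀ i j, inner C(Boundary U, ℂ) (e i) (e j) = if i = j then 1 else 0)
    (hb : ∀ i j, inner C(Corona U, ℂ) (b i) (b j) = if i = j then 1 else 0)
    (F : C(Corona U, Stiefel k m)) (z : Z) :
    (BusbyMorphism.ofFrameMap he hb F).1 z =
      ∑ j, coronaPullback (inner C(Boundary U, ℂ) (e j) z) • ∑ i, frameEntry F i j • b i := rfl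

/-- Busby morphisms correspond to maps to the Stiefel manifold. -/
def BusbyMorphism.frameEquiv
    (he : ∀ i j, inner C(Boundary U, ℂ) (e i) (e j) = if i = j then 1 else 0)
    (hb : ∀ i j, inner C(Corona U, ℂ) (b i) (b j) = if i = j then 1 else 0) :
    BusbyMorphism U V Z ≃ C(Corona U, Stiefel k m) where
  toFun := BusbyMorphism.frameMap he hb
  invFun := BusbyMorphism.ofFrameMap he hb
  left_inv Δ := by
    refine Subtype.ext (funext fun z => ?_)
    rw [ofFrameMap_apply, Δ.apply_eq_sum he z]
    exact Finset.sum_congr rfl fun j _ => congrArg _ (quotient_sum_inner_smul hb (Δ.1 (e j)))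
  right_inv F := by
    refine ContinuousMap.ext fun p => Subtype.ext (funext fun j => PiLp.ext fun i => ?_)
    change inner C(Corona U, ℂ) (b i) ((ofFrameMap he hb F).1 (e j)) p = frameEntry F i j p
    congr 1
    have h1 : (ofFrameMap he hb F).1 (e j) = ∑ i, frameEntry F i j • b i := by
      rw [ofFrameMap_apply]
      simp only [he]
      simp [apply_ite]
    rw [h1, quotient_inner_sum_smul_right hb]

/-- Busby morphisms are joined by a path if and only if the corresponding maps are homotopic. -/
theorem BusbyMorphism.joined_iff_homotopic
    (he : ∀ i j, inner C(Boundary U, ℂ) (e i) (e j) = if i = j then 1 else 0)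
    (hb : ∀ i j, inner C(Corona U, ℂ) (b i) (b j) = if i = j then 1 else 0)
    (Δ Δ' : BusbyMorphism U V Z) :
    Joined Δ Δ' ↔ (frameEquiv he hb Δ).Homotopic (frameEquiv he hb Δ') := by
  constructor
  · rintro ⟨γ⟩
    refine ⟨⟨⟨fun x => frameEquiv he hb (γ x.1) x.2, ?_⟩, fun p => ?_, fun p => ?_⟩⟩
    · refine Continuous.subtype_mk (continuous_pi fun j => ?_) _
      refine (PiLp.continuous_toLp 2 _).comp (continuous_pi fun i => ?_)
      have h1 : Continuous fun t => inner C(Corona U, ℂ) (b i) ((γ t).1 (e j)) :=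
        (quotient_continuous_inner_right (b i)).comp
          ((continuous_apply (e j)).comp (continuous_subtype_val.comp γ.continuous))
      -- Each matrix entry is sup-norm continuous in `t`; as the corona is compact, evaluation is
      -- jointly continuous, and so is the entry in time and point.
      exact continuous_eval.comp ((h1.comp continuous_fst).prodMk continuous_snd)
    · change frameEquiv he hb (γ 0) p = _
      rw [γ.source]
    · change frameEquiv he hb (γ 1) p = _
      rw [γ.target]
  · rintro ⟨h⟩
    refine ⟨⟨⟨fun t => (frameEquiv he hb).symm (h.toContinuousMap.curry t), ?_⟩, ?_, ?_⟩⟩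
    · refine Continuous.subtype_mk (continuous_pi fun z => ?_) _
      refine continuous_finsetSum _ fun j _ => ?_
      -- For fixed `z` the path is a finite combination of the fixed vectors `b i`; only the
      -- coefficients vary with `t`, and currying makes them sup-norm continuous.
      simp_rw [Finset.smul_sum, smul_smul]
      refine continuous_finsetSum _ fun i _ => ?_
      have h1 : Continuous fun t => frameEntry (h.toContinuousMap.curry t) i j :=
        (frameEntry h.toContinuousMap i j).curry.continuous
      exact (quotient_continuous_smul_right (b i)).comp (continuous_const.mul h1)
    · rw [Equiv.symm_apply_eq]
      exact ContinuousMap.ext fun p => h.apply_zero p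
    · rw [Equiv.symm_apply_eq]
      exact ContinuousMap.ext fun p => h.apply_one p

end Frames

/-! ### Maps that preserve inner products -/

section Semilinear

variable {K L : Type*} [TopologicalSpace K] [CompactSpace K] [TopologicalSpace L] [CompactSpace L]
variable {H : Type*} [NormedAddCommGroup H] [NormedSpace ℂ H] [Module C(K, ℂ) H]
  [CStarModule C(K, ℂ) H]
variable {Z : Type*} [NormedAddCommGroup Z] [NormedSpace ℂ Z] [Module C(L, ℂ) Z]
  [CStarModule C(L, ℂ) Z]
variable {φ : C(L, ℂ) →⋆ₐ[ℂ] C(K, ℂ)} {f : Z → H}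

/-- Preservation of inner products alone forces linearity: the inner square of `f (z + z') - (f z +
f z')` is expressed through inner products in `Z`, where it cancels. The same argument gives
semilinearity over `φ`. -/
theorem map_add_of_inner_eq
    (hf : ∀ z z', inner C(K, ℂ) (f z) (f z') = φ (inner C(L, ℂ) z z')) (z z' : Z) :
    f (z + z') = f z + f z' := by
  rw [← sub_eq_zero, ← CStarModule.inner_self (A := C(K, ℂ))]
  simp only [CStarModule.inner_sub_left, CStarModule.inner_sub_right, CStarModule.inner_add_left,
    CStarModule.inner_add_right, hf, map_add]
  ring

theorem map_smul_of_inner_eq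
    (hf : ∀ z z', inner C(K, ℂ) (f z) (f z') = φ (inner C(L, ℂ) z z')) (a : C(L, ℂ)) (z : Z) :
    f (a • z) = φ a • f z := by
  rw [← sub_eq_zero, ← CStarModule.inner_self (A := C(K, ℂ))]
  simp only [CStarModule.inner_sub_left, CStarModule.inner_sub_right,
    CStarModule.inner_op_smul_left, CStarModule.inner_op_smul_right, hf, map_mul, map_star]
  ring

theorem map_complex_smul_of_inner_eq
    (hf : ∀ z z', inner C(K, ℂ) (f z) (f z') = φ (inner C(L, ℂ) z z')) (c : ℂ) (z : Z) :
    f (c • z) = c • f z := by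
  rw [← algebraMap_smul_hilbert (K := L), map_smul_of_inner_eq hf, AlgHomClass.commutes,
    algebraMap_smul_hilbert]

theorem norm_le_of_inner_eq
    (hf : ∀ z z', inner C(K, ℂ) (f z) (f z') = φ (inner C(L, ℂ) z z')) (z : Z) :
    ‖f z‖ ≤ ‖z‖ := by
  refine le_of_sq_le_sq ?_ (norm_nonneg _)
  rw [CStarModule.norm_sq_eq C(K, ℂ), CStarModule.norm_sq_eq C(L, ℂ), hf]
  exact NonUnitalStarAlgHom.norm_apply_le φ _

end Semilinear

/-! ### The extension with a given Busby invariant -/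

section Pullback

variable {X : Type u} [TopologicalSpace X] [CompactSpace X] [T2Space X]
variable {U : TopologicalSpace.Opens X}

/-- The image is compact, hence closed, and contains the dense set `U`. Through this lemma,
functions on `X` can be tested on `βU`. -/
theorem stoneCechMap_surjective (hU : Dense (U : Set X)) :
    Function.Surjective (stoneCechMap U) := by
  have hr : (U : Set X) ⊆ Set.range (stoneCechMap U) := fun x hx =>
    ⟨stoneCechUnit ⟨x, hx⟩, stoneCechMap_unit U ⟨x, hx⟩⟩
  have hc : IsClosed (Set.range (stoneCechMap U)) :=
    (isCompact_range (stoneCechMap U).continuous).isClosed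
  intro x
  exact closure_minimal hr hc (hU x)

theorem mem_frontier_of_notMem (hU : Dense (U : Set X)) {x : X} (hx : x ∉ U) :
    x ∈ frontier (U : Set X) := by
  rw [frontier, U.isOpen.interior_eq, hU.closure_eq]
  exact ⟨trivial, hx⟩

theorem notMem_of_mem_frontier {x : X} (hx : x ∈ frontier (U : Set X)) : x ∉ U := by
  rw [frontier, U.isOpen.interior_eq] at hx
  exact hx.2

theorem coronaMap_surjective (hU : Dense (U : Set X)) : Function.Surjective (coronaMap U) := by
  rintro ⟨x, hx⟩
  obtain ⟨q, rfl⟩ := stoneCechMap_surjective hU x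
  -- A preimage of a boundary point lies in the corona, because points of `U` are mapped into `U`.
  refine ⟨⟨q, ?_⟩, rfl⟩
  rintro ⟨y, rfl⟩
  rw [stoneCechMap_unit] at hx
  exact notMem_of_mem_frontier hx y.2

theorem comp_stoneCechMap_injective (hU : Dense (U : Set X)) {g h : C(X, ℂ)}
    (hgh : g.comp (stoneCechMap U) = h.comp (stoneCechMap U)) : g = h :=
  ContinuousMap.ext fun x => by
    obtain ⟨q, rfl⟩ := stoneCechMap_surjective hU x
    exact DFunLike.congr_fun hgh q

/-- `C(X)` is the pullback of `C(βU)` and `C(∂U)` over `C(βU ∖ U)`. -/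
theorem exists_comp_stoneCechMap_eq (hU : Dense (U : Set X)) {G : C(StoneCech U, ℂ)}
    {h : C(Boundary U, ℂ)} (hGh : coronaRestrict G = h.comp (coronaMap U)) :
    ∃ g : C(X, ℂ), g.comp (stoneCechMap U) = G := by
  classical
  let g : X → ℂ := fun x =>
    if hx : x ∈ U then G (stoneCechUnit ⟨x, hx⟩) else h ⟨x, mem_frontier_of_notMem hU hx⟩
  have hg : g ∘ stoneCechMap U = G := by
    funext q
    by_cases hq : q ∈ Set.range (stoneCechUnit : U → StoneCech U)
    · obtain ⟨y, rfl⟩ := hq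
      have h1 := stoneCechMap_unit U y
      simp [g, h1]
    · have h1 := notMem_of_mem_frontier (stoneCechMap_mem_frontier U ⟨q, hq⟩)
      simp only [g, Function.comp_apply]
      rw [dif_neg h1]
      exact (DFunLike.congr_fun hGh ⟨q, hq⟩).symm
  -- A continuous surjection from a compact space to a Hausdorff space is a quotient map, so the
  -- glued function `g` is continuous as soon as its pullback `G` is.
  have hquot : IsQuotientMap (stoneCechMap U) :=
    (stoneCechMap U).continuous.isClosedMap.isQuotientMap (stoneCechMap U).continuous
      (stoneCechMap_surjective hU)
  refine ⟨⟨g, hquot.continuous_iff.2 (hg ▸ G.continuous)⟩, ContinuousMap.ext fun q => ?_⟩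
  exact congrFun hg q

theorem boundaryRestrict_eq_of_comp (hU : Dense (U : Set X)) {G : C(StoneCech U, ℂ)}
    {h : C(Boundary U, ℂ)} (hGh : coronaRestrict G = h.comp (coronaMap U)) {g : C(X, ℂ)}
    (hg : g.comp (stoneCechMap U) = G) : boundaryRestrict U g = h := by
  subst hg
  refine ContinuousMap.ext fun x => ?_
  obtain ⟨p, rfl⟩ := coronaMap_surjective hU x
  exact DFunLike.congr_fun hGh p

theorem norm_comp_stoneCechMap (hU : Dense (U : Set X)) (g : C(X, ℂ)) :
    ‖g.comp (stoneCechMap U)‖ = ‖g‖ := by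
  refine le_antisymm ?_ ?_
  · exact (ContinuousMap.norm_le _ (norm_nonneg _)).2 fun q => g.norm_coe_le_norm _
  · refine (ContinuousMap.norm_le _ (norm_nonneg _)).2 fun x => ?_
    obtain ⟨q, rfl⟩ := stoneCechMap_surjective hU x
    exact (g.comp (stoneCechMap U)).norm_coe_le_norm q

variable {V : Type v} [NormedAddCommGroup V] [NormedSpace ℂ V] [SMul C₀(U, ℂ) V]
  [CStarModule C₀(U, ℂ) V] [CompleteSpace V]
variable {Z : Type w} [NormedAddCommGroup Z] [NormedSpace ℂ Z] [Module C(Boundary U, ℂ) Z]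
  [CStarModule C(Boundary U, ℂ) Z]
variable (Δ : BusbyMorphism U V Z)

/-- A Busby morphism as a linear map. -/
def BusbyMorphism.toLinearMap : Z →ₗ[ℂ] QuotientModule C₀(U, ℂ) V where
  toFun := Δ.1
  map_add' :=
    letI := quotientNormedAddCommGroup U V
    map_add_of_inner_eq (φ := coronaPullback) Δ.inner_eq
  map_smul' :=
    letI := quotientNormedAddCommGroup U V
    map_complex_smul_of_inner_eq (φ := coronaPullback) Δ.inner_eq

theorem BusbyMorphism.toLinearMap_apply (z : Z) : Δ.toLinearMap z = Δ.1 z := rfl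

theorem BusbyMorphism.map_smul (a : C(Boundary U, ℂ)) (z : Z) :
    Δ.1 (a • z) = coronaPullback a • Δ.1 z :=
  letI := quotientNormedAddCommGroup U V
  map_smul_of_inner_eq (φ := coronaPullback) Δ.inner_eq a z

theorem BusbyMorphism.continuous : Continuous Δ.1 :=
  AddMonoidHomClass.continuous_of_bound Δ.toLinearMap 1 fun z => by
    rw [one_mul]
    let := quotientNormedAddCommGroup U V
    exact norm_le_of_inner_eq (φ := coronaPullback) Δ.inner_eq z

/-- The pullback of `M(V)` and `Z` over `Q(V)`. -/
def pullbackSubmodule : Submodule ℂ (MultiplierModule C₀(U, ℂ) V × Z) :=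
  LinearMap.eqLocus (toQuotient C₀(U, ℂ) V ∘ₗ LinearMap.fst ℂ _ _)
    (Δ.toLinearMap ∘ₗ LinearMap.snd ℂ _ _)

/-- The pullback of `M(V)` and `Z` over `Q(V)`. -/
def PullbackModule : Type max u v w := ↥(pullbackSubmodule Δ)

instance : NormedAddCommGroup (PullbackModule Δ) :=
  inferInstanceAs (NormedAddCommGroup ↥(pullbackSubmodule Δ))

instance : NormedSpace ℂ (PullbackModule Δ) :=
  inferInstanceAs (NormedSpace ℂ ↥(pullbackSubmodule Δ))

variable {Δ}

theorem pullback_ext {x y : PullbackModule Δ} (h : x.1.1 = y.1.1) (h' : x.1.2 = y.1.2) : x = y :=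
  Subtype.ext (Prod.ext h h')

theorem pullback_condition (x : PullbackModule Δ) :
    toQuotient C₀(U, ℂ) V x.1.1 = Δ.1 x.1.2 := x.2

instance [CompleteSpace Z] : CompleteSpace (PullbackModule Δ) := by
  -- The locus where two continuous maps to `Q(V)` agree is closed because `Q(V)` is Hausdorff,
  -- which is where the norm property enters.
  let := quotientNormedAddCommGroup U V
  have hc : IsClosed (pullbackSubmodule Δ : Set (MultiplierModule C₀(U, ℂ) V × Z)) :=
    isClosed_eq (continuous_toQuotient.comp continuous_fst) (Δ.continuous.comp continuous_snd)
  exact hc.completeSpace_coe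

theorem coronaRestrict_comp_stoneCechMap (g : C(X, ℂ)) :
    coronaRestrict (g.comp (stoneCechMap U)) = coronaPullback (boundaryRestrict U g) := rfl

instance : SMul C(X, ℂ) (PullbackModule Δ) where
  smul g x := ⟨(g.comp (stoneCechMap U) • x.1.1, boundaryRestrict U g • x.1.2), by
    change toQuotient C₀(U, ℂ) V (g.comp (stoneCechMap U) • x.1.1) =
      Δ.1 (boundaryRestrict U g • x.1.2)
    rw [coronaRestrict_smul_toQuotient', Δ.map_smul, coronaRestrict_comp_stoneCechMap,
      pullback_condition]⟩

theorem pullback_smul_fst (g : C(X, ℂ)) (x : PullbackModule Δ) :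
    (g • x).1.1 = g.comp (stoneCechMap U) • x.1.1 := rfl

instance : Module C(X, ℂ) (PullbackModule Δ) where
  one_smul x := pullback_ext (one_smul C(StoneCech U, ℂ) x.1.1)
    (one_smul C(Boundary U, ℂ) x.1.2)
  mul_smul f g x := pullback_ext
    (mul_smul (f.comp (stoneCechMap U)) (g.comp (stoneCechMap U)) x.1.1)
    (mul_smul (boundaryRestrict U f) (boundaryRestrict U g) x.1.2)
  smul_zero g := pullback_ext (smul_zero (g.comp (stoneCechMap U)))
    (smul_zero (boundaryRestrict U g))
  smul_add g x y := pullback_ext (smul_add (g.comp (stoneCechMap U)) x.1.1 y.1.1)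
    (smul_add (boundaryRestrict U g) x.1.2 y.1.2)
  add_smul f g x := pullback_ext
    (add_smul (f.comp (stoneCechMap U)) (g.comp (stoneCechMap U)) x.1.1)
    (add_smul (boundaryRestrict U f) (boundaryRestrict U g) x.1.2)
  zero_smul x := pullback_ext (zero_smul C(StoneCech U, ℂ) x.1.1)
    (zero_smul C(Boundary U, ℂ) x.1.2)

/-- The gluing condition that allows the two inner products to come from a single function on `X`.
-/
theorem pullback_compatible (x y : PullbackModule Δ) :
    coronaRestrict (multiplierInner x.1.1 y.1.1) =
      (inner C(Boundary U, ℂ) x.1.2 y.1.2).comp (coronaMap U) := by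
  rw [← inner_toQuotient, pullback_condition, pullback_condition]
  exact Δ.2 _ _

/-- The `C(X)`-valued inner product on the pullback. -/
def pullbackInner (hU : Dense (U : Set X)) (x y : PullbackModule Δ) : C(X, ℂ) :=
  (exists_comp_stoneCechMap_eq hU (pullback_compatible x y)).choose

theorem pullbackInner_comp (hU : Dense (U : Set X)) (x y : PullbackModule Δ) :
    (pullbackInner hU x y).comp (stoneCechMap U) = inner C(StoneCech U, ℂ) x.1.1 y.1.1 :=
  (exists_comp_stoneCechMap_eq hU (pullback_compatible x y)).choose_spec

theorem boundaryRestrict_pullbackInner (hU : Dense (U : Set X)) (x y : PullbackModule Δ) :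
    boundaryRestrict U (pullbackInner hU x y) = inner C(Boundary U, ℂ) x.1.2 y.1.2 :=
  boundaryRestrict_eq_of_comp hU (pullback_compatible x y) (pullbackInner_comp hU x y)

theorem pullbackInner_eq (hU : Dense (U : Set X)) {x y : PullbackModule Δ} {g : C(X, ℂ)}
    (h : inner C(StoneCech U, ℂ) x.1.1 y.1.1 = g.comp (stoneCechMap U)) :
    pullbackInner hU x y = g :=
  comp_stoneCechMap_injective hU ((pullbackInner_comp hU x y).trans h)

/-- The norm of the pullback is the maximum of the norms of the two components. The first component
attains it: pulling back along the surjection `βU → X` preserves the sup norm, whereas restricting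
to `∂U` can only decrease it. -/
theorem pullback_norm_sq (hU : Dense (U : Set X)) (x : PullbackModule Δ) :
    ‖x‖ ^ 2 = ‖pullbackInner hU x x‖ := by
  have h1 : ‖x.1.1‖ ^ 2 = ‖pullbackInner hU x x‖ := by
    rw [CStarModule.norm_sq_eq C(StoneCech U, ℂ), ← pullbackInner_comp hU,
      norm_comp_stoneCechMap hU]
  have h2 : ‖x.1.2‖ ^ 2 ≤ ‖pullbackInner hU x x‖ := by
    rw [CStarModule.norm_sq_eq C(Boundary U, ℂ), ← boundaryRestrict_pullbackInner hU]
    exact (ContinuousMap.norm_le _ (norm_nonneg _)).2 fun p =>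
      (pullbackInner hU x x).norm_coe_le_norm p.1
  have h3 : ‖x‖ = max ‖x.1.1‖ ‖x.1.2‖ := rfl
  rw [h3, max_eq_left, h1]
  exact le_of_sq_le_sq (h2.trans h1.ge) (norm_nonneg _)

variable (Δ) in
/-- The pullback as a Hilbert module over `C(X)`. -/
@[reducible]
def pullbackCStarModule (hU : Dense (U : Set X)) : CStarModule C(X, ℂ) (PullbackModule Δ) where
  inner := pullbackInner hU
  inner_add_right {x y z} := pullbackInner_eq hU <| by
    change inner C(StoneCech U, ℂ) x.1.1 (y.1.1 + z.1.1) = _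
    rw [CStarModule.inner_add_right, ← pullbackInner_comp hU, ← pullbackInner_comp hU]
    rfl
  inner_self_nonneg {x} := fun p => by
    obtain ⟨q, rfl⟩ := stoneCechMap_surjective hU p
    have h1 := DFunLike.congr_fun (pullbackInner_comp hU x x) q
    change 0 ≤ pullbackInner hU x x (stoneCechMap U q)
    rw [ContinuousMap.comp_apply] at h1
    rw [h1]
    exact multiplierInner_self_nonneg x.1.1 q
  inner_self {x} := by
    rw [← norm_eq_zero, ← pullback_norm_sq, sq_eq_zero_iff, norm_eq_zero]
  inner_op_smul_right {g x y} := pullbackInner_eq hU <| by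
    rw [pullback_smul_fst, CStarModule.inner_op_smul_right, ← pullbackInner_comp hU]
    rfl
  inner_smul_right_complex {c x y} := pullbackInner_eq hU <| by
    change inner C(StoneCech U, ℂ) x.1.1 (c • y.1.1) = _
    rw [CStarModule.inner_smul_right_complex, ← pullbackInner_comp hU]
    rfl
  star_inner x y := (pullbackInner_eq hU <| by
    rw [← CStarModule.star_inner, ← pullbackInner_comp hU]
    rfl).symm
  norm_eq_sqrt_norm_inner_self x := by
    rw [← pullback_norm_sq, Real.sqrt_sq (norm_nonneg _)]

theorem inner_multiplierIncl (x x' : V) :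
    inner C(StoneCech U, ℂ) (multiplierIncl C₀(U, ℂ) V x) (multiplierIncl C₀(U, ℂ) V x') =
      (extendByZero U (inner C₀(U, ℂ) x x')).comp (stoneCechMap U) :=
  multiplierInner_eq fun a b y => by
    rw [multiplierIncl_apply, multiplierIncl_apply, CStarModule.inner_op_smul_right,
      CStarModule.inner_op_smul_left, ContinuousMap.comp_apply, stoneCechMap_unit,
      extendByZero_apply_mem, ZeroAtInftyContinuousMap.mul_apply,
      ZeroAtInftyContinuousMap.mul_apply, ZeroAtInftyContinuousMap.star_apply]
    ring

variable (Δ) in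
/-- The extension with Busby invariant `Δ`. -/
def pullbackExtension [CompleteSpace Z] (hU : Dense (U : Set X)) : Extension U V Z :=
  letI := pullbackCStarModule Δ hU
  { W := PullbackModule Δ
    incl :=
      { toFun := fun x => ⟨(multiplierIncl C₀(U, ℂ) V x, 0), by
          change toQuotient C₀(U, ℂ) V (multiplierIncl C₀(U, ℂ) V x) = Δ.toLinearMap 0
          rw [map_zero, toQuotient_eq_zero_iff]
          exact ⟨x, rfl⟩⟩
        map_add' := fun x y => pullback_ext (map_add _ _ _) (add_zero 0).symm
        map_smul' := fun c x => pullback_ext (map_smul _ _ _) (smul_zero c).symm }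
    inner_incl := fun x x' => pullbackInner_eq hU (inner_multiplierIncl x x')
    proj :=
      { toFun := fun x => x.1.2
        map_add' := fun _ _ => rfl
        map_smul' := fun _ _ => rfl }
    inner_proj := fun x y => (boundaryRestrict_pullbackInner hU x y).symm
    injective_incl := fun x y h => by
      have h1 : multiplierIncl C₀(U, ℂ) V x = multiplierIncl C₀(U, ℂ) V y :=
        congrArg (fun p : PullbackModule Δ => p.1.1) h
      -- The map `V → M(V)` preserves inner products, so a vector in its kernel has inner square
      -- zero.
      have h2 := inner_multiplierIncl (U := U) (x - y) (x - y)
      rw [map_sub, h1, sub_self, CStarModule.inner_zero_right] at h2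
      rw [← sub_eq_zero, ← CStarModule.inner_self (A := C₀(U, ℂ))]
      refine extendByZero_injective ?_
      rw [← comp_stoneCechMap_injective hU (g := 0) h2]
      exact (extendByZero_ext (fun _ => rfl) fun _ _ => rfl).symm
    exact_incl_proj := fun y => by
      refine ⟨fun h => ?_, ?_⟩
      -- A pair `(T, 0)` in the pullback has `T` trivial in `Q(V)`, that is, `T` comes from `V`.
      · have h1 := pullback_condition y
        have h2 : y.1.2 = 0 := h
        rw [h2, ← Δ.toLinearMap_apply, map_zero, toQuotient_eq_zero_iff] at h1
        obtain ⟨x, hx⟩ := h1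
        exact ⟨x, pullback_ext hx h2.symm⟩
      · rintro ⟨x, rfl⟩
        rfl
    surjective_proj := fun z => by
      obtain ⟨T, hT⟩ := toQuotient_surjective (Δ.1 z)
      exact ⟨⟨(T, z), hT⟩, rfl⟩ }

/-- Every Busby morphism is the Busby invariant of an extension. -/
theorem busby_pullbackExtension [CompleteSpace Z] (hU : Dense (U : Set X)) :
    (pullbackExtension Δ hU).busby = Δ := by
  refine Subtype.ext (funext fun z => ?_)
  obtain ⟨y, rfl⟩ := (pullbackExtension Δ hU).surjective_proj z
  rw [Extension.busby_proj]
  -- Multiplication by `a ∈ C₀(U)` sends `(T, z)` to the image of `T a ∈ V`: the second component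
  -- dies because `a` vanishes on `∂U`, and on the first, `c • T a = T (c * a)`. So the multiplier
  -- of `(T, z)` is `T`, whose class is `Δ.1 z` by definition of the pullback.
  have h1 : (pullbackExtension Δ hU).toMultiplier y = (y : PullbackModule Δ).1.1 := by
    refine Extension.toMultiplier_eq_of_incl _ fun a => pullback_ext ?_ ?_
    · refine multiplier_ext fun c => ?_
      change c • ((y : PullbackModule Δ).1.1 a) =
        (y : PullbackModule Δ).1.1 (mulC0 ((extendByZero U a).comp (stoneCechMap U)) c)
      rw [← multiplier_map_mul]
      refine congrArg (y : PullbackModule Δ).1.1.1 (ZeroAtInftyContinuousMap.ext fun q => ?_)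
      rw [mulC0_apply, ContinuousMap.comp_apply, stoneCechMap_unit, extendByZero_apply_mem,
        ZeroAtInftyContinuousMap.mul_apply, mul_comm]
    · have h2 : boundaryRestrict U (extendByZero U a) = 0 := ContinuousMap.ext fun p =>
        extendByZero_apply_notMem U a (notMem_of_mem_frontier p.2)
      change 0 = boundaryRestrict U (extendByZero U a) • (y : PullbackModule Δ).1.2
      rw [h2, zero_smul]
  rw [h1]
  exact pullback_condition (y : PullbackModule Δ)

end Pullback

/-! ### The standard module -/

section Standard

variable {Y : Type u} [TopologicalSpace Y] [T35Space Y] [LocallyCompactSpace Y] {m : ℕ}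

variable (Y m) in
/-- The standard Hilbert module `C₀(Y)^m`. -/
abbrev StandardModule : Type u := WithCStarModule C₀(Y, ℂ) (Fin m → C₀(Y, ℂ))

/-- The multiplier that embeds `C₀(Y)` as the `i`-th summand of `C₀(Y)^m`. -/
def coordMultiplier (i : Fin m) : MultiplierModule C₀(Y, ℂ) (StandardModule Y m) :=
  ⟨LinearMap.mkContinuous
    { toFun := fun a => (WithCStarModule.equiv C₀(Y, ℂ) _).symm (Pi.single i a)
      map_add' := fun a b => by rw [Pi.single_add]; rfl
      map_smul' := fun c a => by rw [Pi.single_smul']; rfl } 1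
    (fun a => by
      rw [one_mul]
      exact (WithCStarModule.norm_single (A := C₀(Y, ℂ)) (E := fun _ : Fin m => C₀(Y, ℂ)) i a).le),
    fun x => x i, fun a x =>
      WithCStarModule.inner_single_left (A := C₀(Y, ℂ)) (E := fun _ : Fin m => C₀(Y, ℂ)) x a⟩

theorem coordMultiplier_apply (i : Fin m) (a : C₀(Y, ℂ)) :
    coordMultiplier i a =
      (WithCStarModule.equiv C₀(Y, ℂ) (Fin m → C₀(Y, ℂ))).symm (Pi.single i a) := rfl

theorem coordMultiplier_apply_apply (i j : Fin m) (a : C₀(Y, ℂ)) :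
    coordMultiplier i a j = if i = j then a else 0 := by
  rw [coordMultiplier_apply]
  change Pi.single (M := fun _ => C₀(Y, ℂ)) i a j = _
  rw [Pi.single_apply]
  simp [eq_comm]

theorem inner_coordMultiplier_left (i : Fin m) (a : C₀(Y, ℂ)) (x : StandardModule Y m) :
    inner C₀(Y, ℂ) (coordMultiplier i a) x = x i * star a :=
  (WithCStarModule.inner_single_left (A := C₀(Y, ℂ)) (E := fun _ : Fin m => C₀(Y, ℂ)) x a).trans
    (WithCStarModule.inner_def _ _)

theorem multiplierInner_coordMultiplier (i j : Fin m) :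
    multiplierInner (coordMultiplier i : MultiplierModule C₀(Y, ℂ) (StandardModule Y m))
      (coordMultiplier j) = if i = j then 1 else 0 :=
  multiplierInner_eq fun a b y => by
    rw [inner_coordMultiplier_left, coordMultiplier_apply_apply]
    by_cases h : i = j
    · rw [if_pos h, if_pos h.symm, ContinuousMap.one_apply, mul_one, mul_comm]
      rfl
    · rw [if_neg h, if_neg (Ne.symm h), ContinuousMap.zero_apply, mul_zero, zero_mul, zero_mul]
      rfl

theorem multiplier_sum_apply {V : Type v} [NormedAddCommGroup V] [NormedSpace ℂ V]
    [SMul C₀(Y, ℂ) V] [CStarModule C₀(Y, ℂ) V] {ι : Type*} (s : Finset ι)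
    (T : ι → MultiplierModule C₀(Y, ℂ) V) (a : C₀(Y, ℂ)) : (∑ i ∈ s, T i) a = ∑ i ∈ s, T i a :=
  map_sum ({ toFun := fun T => T a, map_zero' := rfl, map_add' := fun _ _ => rfl } :
    MultiplierModule C₀(Y, ℂ) V →+ V) T s

/-- The inner product of the `i`-th coordinate multiplier with `T` is the function multiplying `a`
into the `i`-th coordinate of `T a`. Every multiplier thus expands in the coordinate multipliers
already in `M(V)`, and the expansion descends to `Q(V)`. -/
theorem sum_multiplierInner_smul_coordMultiplier
    (T : MultiplierModule C₀(Y, ℂ) (StandardModule Y m)) :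
    ∑ i, multiplierInner (coordMultiplier i) T • coordMultiplier i = T := by
  refine multiplier_ext fun a => ?_
  rw [multiplier_sum_apply]
  have h1 : ∀ i, (multiplierInner (coordMultiplier i) T • coordMultiplier i) a =
      coordMultiplier i ((T a) i) := fun i => by
    rw [multiplier_smul_eq, actionMap_apply]
    refine congrArg (coordMultiplier i).1 (ZeroAtInftyContinuousMap.ext fun y => ?_)
    rw [mulC0_apply]
    -- A function `c` with `c y = 1` isolates the value at `y` in the defining identity of the inner
    -- product.
    obtain ⟨c, hc, -⟩ := exists_local_unit y
    have h2 := multiplierInner_spec (coordMultiplier i) T c a y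
    rw [inner_coordMultiplier_left, ZeroAtInftyContinuousMap.mul_apply,
      ZeroAtInftyContinuousMap.star_apply, hc.self_of_nhds] at h2
    simpa using h2.symm
  simp_rw [h1]
  refine hilbert_ext (A := C₀(Y, ℂ)) fun z => ?_
  rw [CStarModule.inner_sum_left]
  simp_rw [inner_coordMultiplier_left]
  rw [WithCStarModule.pi_inner]
  rfl

/-- `Q(C₀(Y)^m)` is free of rank `m`. -/
theorem nonempty_basis_quotient_standardModule :
    Nonempty (Module.Basis (Fin m) C(Corona Y, ℂ)
      (QuotientModule C₀(Y, ℂ) (StandardModule Y m))) := by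
  refine quotient_nonempty_basis_of_orthonormal
    (e := fun i => toQuotient _ _ (coordMultiplier i)) (fun i j => ?_) fun q => ?_
  · rw [inner_toQuotient, multiplierInner_coordMultiplier]
    split_ifs <;> simp
  · obtain ⟨T, rfl⟩ := toQuotient_surjective q
    conv_rhs => rw [← sum_multiplierInner_smul_coordMultiplier T, map_sum]
    exact Finset.sum_congr rfl fun i _ => (coronaRestrict_smul_toQuotient' _ _).symm

end Standard

/-! ### Homotopy classes of extensions -/

section Classification

variable {X : Type u} [TopologicalSpace X] [CompactSpace X] [T2Space X]
variable {U : TopologicalSpace.Opens X}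
variable {V : Type v} [NormedAddCommGroup V] [NormedSpace ℂ V] [SMul C₀(U, ℂ) V]
  [CStarModule C₀(U, ℂ) V] [CompleteSpace V]
variable {Z : Type w} [NormedAddCommGroup Z] [NormedSpace ℂ Z] [Module C(Boundary U, ℂ) Z]
  [CStarModule C(Boundary U, ℂ) Z]
variable {k m : ℕ} {e : Module.Basis (Fin k) C(Boundary U, ℂ) Z}
  {b : Module.Basis (Fin m) C(Corona U, ℂ) (QuotientModule C₀(U, ℂ) V)}

/-- The class of the map to the Stiefel manifold defined by a homotopy class of extensions. -/
def frameClass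
    (he : ∀ i j, inner C(Boundary U, ℂ) (e i) (e j) = if i = j then 1 else 0)
    (hb : ∀ i j, inner C(Corona U, ℂ) (b i) (b j) = if i = j then 1 else 0) :
    ExtensionClasses U V Z → HomotopyClasses (Corona U) (Stiefel k m) :=
  Quotient.map' (fun E => BusbyMorphism.frameEquiv he hb E.busby) fun _ _ h =>
    (BusbyMorphism.joined_iff_homotopic he hb _ _).1 h

/-- Injectivity turns a homotopy of frame maps back into a path of Busby invariants; surjectivity
realises the morphism with matrix `F` by the pullback extension, and only here is density of `U`
used. Since homotopy depends on Busby invariants alone, extensions need not be compared up to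
isomorphism. -/
theorem frameClass_bijective [CompleteSpace Z] (hU : Dense (U : Set X))
    (he : ∀ i j, inner C(Boundary U, ℂ) (e i) (e j) = if i = j then 1 else 0)
    (hb : ∀ i j, inner C(Corona U, ℂ) (b i) (b j) = if i = j then 1 else 0) :
    Function.Bijective (frameClass he hb) := by
  constructor
  · rintro ⟨E⟩ ⟨E'⟩ h
    exact Quotient.sound' ((BusbyMorphism.joined_iff_homotopic he hb _ _).2 (Quotient.exact h))
  · rintro ⟨F⟩
    refine ⟨(pullbackExtension ((BusbyMorphism.frameEquiv he hb).symm F) hU).homotopyClass, ?_⟩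
    change mapClass (BusbyMorphism.frameEquiv he hb (pullbackExtension _ hU).busby) = mapClass F
    rw [busby_pullbackExtension, Equiv.apply_symm_apply]

end Classification

end HilbertModuleExtensions

end

theorem mainTheorem4 {X : Type*} [TopologicalSpace X] [CompactSpace X] [T2Space X]
    (U : TopologicalSpace.Opens X) (hU : Dense (U : Set X)) (k m : ℕ) :
    (∀ (V : Type*) [NormedAddCommGroup V] [NormedSpace ℂ V] [SMul C₀(U, ℂ) V]
        [CStarModule C₀(U, ℂ) V] [CompleteSpace V]
        (Z : Type*) [NormedAddCommGroup Z] [NormedSpace ℂ Z]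
        [Module C(Boundary U, ℂ) Z]
        [CStarModule C(Boundary U, ℂ) Z] [CompleteSpace Z],
      Nonempty (Module.Basis (Fin k) C(Boundary U, ℂ) Z) →
      Nonempty (Module.Basis (Fin m) C(Corona U, ℂ)
        (QuotientModule C₀(U, ℂ) V)) →
      ∃ (e : Module.Basis (Fin k) C(Boundary U, ℂ) Z)
        (b : Module.Basis (Fin m) C(Corona U, ℂ)
          (QuotientModule C₀(U, ℂ) V)),
        (∀ i j, inner C(Boundary U, ℂ) (e i) (e j) =
          if i = j then 1 else 0) ∧
        (∀ i j, inner C(Corona U, ℂ) (b i) (b j) =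
          if i = j then 1 else 0) ∧
        ∃ Ψ : ExtensionClasses U V Z ≃
            HomotopyClasses (Corona U)
              (Stiefel k m),
          ∀ E : Extension U V Z,
            ∃ F : C(Corona U, Stiefel k m),
              (∀ i j p, inner C(Corona U, ℂ) (b i) (E.busby.1 (e j)) p =
                (F p).1 j i) ∧
              Ψ E.homotopyClass = mapClass F) ∧
    Nonempty (Module.Basis (Fin m) C(Corona U, ℂ)
      (QuotientModule C₀(U, ℂ)
        (WithCStarModule C₀(U, ℂ) (Fin m → C₀(U, ℂ))))) := by
  refine ⟨?_, nonempty_basis_quotient_standardModule⟩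
  rintro V _ _ _ _ _ Z _ _ _ _ _ ⟨e₀⟩ ⟨b₀⟩
  obtain ⟨e, he⟩ := exists_orthonormal_basis e₀
  obtain ⟨b, hb⟩ := quotient_exists_orthonormal_basis b₀
  -- The bijection is induced by the matrix map on representatives, so the explicit formula holds by
  -- definition.
  exact ⟨e, b, he, hb, Equiv.ofBijective _ (frameClass_bijective hU he hb), fun E =>
    ⟨BusbyMorphism.frameEquiv he hb E.busby, fun _ _ _ => rfl, rfl⟩⟩
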